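/- **Setting.** Let $V$ be a set of $n$ nodes. For each round $t=1,\dots,N$ let a set of active edges (an undirected simple graph on $V$) be given; this fixed sequence $\boldsymbol M=(\boldsymbol M_t)_{t\le N}$ is the communication pattern. Let $d_t(u)$ be the number of active edges at $u$ in round $t$, and $\Delta=\max_{t,u}d_t(u)$. Let $P_t[u,v]=\frac1{2\Delta}$ if $\{u,v\}$ is active in round $t$, $P_t[u,u]=1-\frac{d_t(u)}{2\Delta}$, and $P_t[u,v]=0$ otherwise. A window of consecutive rounds is $\varepsilon$-smoothing if for every vector $x\ge 0$ with $\|x\|_\infty=1$ the largest and the smallest entry of $x\cdot\prod_t P_t$ (the product over the window, in the order of time) differ by at most $\varepsilon$. Let $t_{\mathrm{mix}}$ be the least $\ell$ such that every window of $\ell$ consecutive rounds in $\{1,\dots,N\}$ is $n^{-5}$-smoothing. Each node $u$ has an initial opinion $o_u$ out of $k$ opinions. The plurality opinion $p$ is the one with strictly the most supporters; the initial bias $\alpha$ is the number of supporters of $p$ minus the number of supporters of the strongest other opinion ($0$ if $k=1$), divided by $n$. Logarithms are binary. **Protocol Shuffle** (with parameters $\gamma$ and $t_{\mathrm{mix}}$).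 At time $0$ each node $u$ creates $\gamma$ tokens labeled $o_u$, sets $c_u:=0$ and $(\mathrm{dom}_u,e_u):=(o_u,0)$; its guess $\mathrm{plu}_u$ is arbitrary. In each round $t=1,\dots,N$: (1) *shuffle:* independently of the other nodes and of the past, each node sends $\gamma/(2\Delta)$ of its tokens, chosen uniformly at random without replacement, over each of its active edges; (2) *broadcast:* each node $u$ replaces $(\mathrm{dom}_u,e_u)$ by the pair $(\mathrm{dom}_w,e_w)$ with the largest $e_w$ among $u$ and its active neighbours (ties are broken arbitrarily); (3) *update:* if $t_{\mathrm{mix}}\mid t$, each node $u$ increases $c_u$ by the number of tokens labeled $o_u$ that it holds, sets $\mathrm{plu}_u:=\mathrm{dom}_u$, and then resets $(\mathrm{dom}_u,e_u):=(o_u,c_u)$. **Theorem.** For every $q\in\mathbb N$ there are constants $C,n_0\in\mathbb N$ such that the following holds for all $n\ge n_0$, all $N$, all communication patterns $(\boldsymbol M_t)_{t\le N}$, all $k$, all initial opinions with a plurality opinion $p$, all integers $T\ge1$ and all reals $c\ge12$. Let $\gamma=\left\lceil\frac{c\log n}{\alpha^2T}\right\rceil$ and suppose that $2\Delta$ divides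 $\gamma$. Then: 1. With probability at least $1-n^{-q}$, however ties are broken, $\mathrm{plu}_u=p$ holds for all nodes $u$ after $t$ rounds, simultaneously for all $t$ with $C\,T\,t_{\mathrm{mix}}\le t\le N$. That is, after $O(T\cdot t_{\mathrm{mix}})$ rounds all nodes know the plurality opinion and do not change their guess any more. 2. During the first $C\,T\,t_{\mathrm{mix}}$ rounds, all that a node stores (the labels of its tokens, its own opinion, $c_u$, $\mathrm{dom}_u$, $e_u$, $\mathrm{plu}_u$ and the number of the current round) fits into an integral number of bits that is at most $$\left(\frac{c\log n}{\alpha^2T}+4\right)\log k+4\log\left(\frac{c\log n}{\alpha^2}\right)+\log(T\cdot t_{\mathrm{mix}}).$$ For $c=12$ this is the bound $\left(12\cdot\frac{\log n}{\alpha^2T}+4\right)\log k+4\log\left(\frac{12\log n}{\alpha^2}\right)+\log(T\cdot t_{\mathrm{mix}})$. -/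

import Mathlib

namespace Plurality

open Matrix

noncomputable section

/-! ### Communication patterns, transition matrices, mixing time

A communication pattern is a sequence `M` of graphs on the node set `V`: the edges of `M t` are the
active edges of round `t`, for rounds `t = 1, …, N`. -/

variable {V : Type*} [Fintype V]

/-- The active degree `d_t(u)`: the number of nodes other than `u` to which `u` has an active edge. -/
def activeDegree (M : ℕ → SimpleGraph V) (t : ℕ) (u : V) : ℕ := ((M t).neighborSet u).ncard

/-- `Δ`, the maximum active degree of any node in any of the rounds `1, …, N`. -/
def maxActiveDegree (N : ℕ) (M : ℕ → SimpleGraph V) : ℕ :=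
  (Finset.Icc 1 N).sup fun t => Finset.univ.sup fun u => activeDegree M t u

open Classical in
/-- The transition matrix `P_t` of the lazy random walk on the edges active in round `t`. -/
def transition (N : ℕ) (M : ℕ → SimpleGraph V) (t : ℕ) : Matrix V V ℝ := fun u v =>
  if u = v then 1 - (activeDegree M t u : ℝ) / (2 * (maxActiveDegree N M : ℝ))
  else if (M t).Adj u v then 1 / (2 * (maxActiveDegree N M : ℝ))
  else 0

open Classical in
/-- The ordered product `P_t * P_{t+1} * ⋯ * P_{t+ℓ-1}` over the `ℓ` rounds that start with
round `t`. -/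
def windowProd (N : ℕ) (M : ℕ → SimpleGraph V) (t ℓ : ℕ) : Matrix V V ℝ :=
  ((List.range ℓ).map fun i => transition N M (t + i)).prod

/-- The discrepancy of a vector: maximal entry minus minimal entry. -/
def disc (y : V → ℝ) : ℝ := (⨆ v, y v) - ⨅ v, y v

/-- The window of `ℓ` rounds that starts with round `t` is `ε`-smoothing. (`‖x‖` is the maximum
norm.) -/
def IsSmoothing (N : ℕ) (M : ℕ → SimpleGraph V) (t ℓ : ℕ) (ε : ℝ) : Prop :=
  ∀ x : V → ℝ, (∀ v, 0 ≤ x v) → ‖x‖ = 1 → disc (x ᵥ* windowProd N M t ℓ) ≤ ε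

/-- The mixing time `t_mix(ε)`: the least `ℓ` such that each window of `ℓ` consecutive rounds among
`1, …, N` is `ε`-smoothing. -/
def mixingTime (N : ℕ) (M : ℕ → SimpleGraph V) (ε : ℝ) : ℕ :=
  sInf {ℓ | ∀ t, 1 ≤ t → t + ℓ ≤ N + 1 → IsSmoothing N M t ℓ ε}

/-- `t_mix = t_mix(n⁻⁵)`, where `n` is the number of nodes. -/
def tmix (N : ℕ) (M : ℕ → SimpleGraph V) : ℕ :=
  mixingTime N M (1 / (Fintype.card V : ℝ) ^ 5)

/-! ### Opinions -/

/-- The number of nodes with initial opinion `i`. -/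
def supporters {k : ℕ} (o : V → Fin k) (i : Fin k) : ℕ := {u | o u = i}.ncard

/-- `p` is the plurality opinion: it has strictly more supporters than any other opinion. -/
def IsPlurality {k : ℕ} (o : V → Fin k) (p : Fin k) : Prop :=
  ∀ i, i ≠ p → supporters o i < supporters o p

/-- The initial bias towards `p`: the supporters of `p` minus those of the strongest competitor,
divided by the number of nodes. -/
def bias {k : ℕ} (o : V → Fin k) (p : Fin k) : ℝ :=
  ((supporters o p : ℝ) - (((Finset.univ.erase p).sup (supporters o) : ℕ) : ℝ)) / Fintype.card V

/-- The number of tokens per node, `γ = ⌈c · log₂ n / (α² T)⌉`. -/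
def tokensPerNode (c : ℝ) (n : ℕ) (α : ℝ) (T : ℕ) : ℕ :=
  ⌈c * Real.logb 2 n / (α ^ 2 * T)⌉₊

/-! ### The shuffle part

Tokens are pairs `(v, i)` with `v` the node that created the token and `i < γ`. A placement says
where each token currently is. -/

/-- The placements that one execution of the shuffle part in round `t` can produce from the placement
`pos`: every node `u` hands exactly `P_t[u,v] · γ` of the tokens it holds to each node `v` (where
`v = u` stands for the tokens it keeps). -/
def shuffleOutcomes (N : ℕ) (M : ℕ → SimpleGraph V) (γ t : ℕ) (pos : V × Fin γ → V) :
    Set (V × Fin γ → V) :=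
  {pos' | ∀ u v, (({j | pos j = u ∧ pos' j = v}.ncard : ℕ) : ℝ) = transition N M t u v * γ}

open Classical in
/-- The law of the placement after the shuffle part of round `t`: uniform over the possible outcomes.
So, independently for all nodes, the sets of tokens sent to the different neighbours are chosen
uniformly at random without replacement. (If `2Δ` divides `γ` and each node holds `γ` tokens, then
outcomes exist and each node holds `γ` tokens afterwards; the other branch is then irrelevant.) -/
def shuffleStep (N : ℕ) (M : ℕ → SimpleGraph V) (γ t : ℕ) (pos : V × Fin γ → V) :
    PMF (V × Fin γ → V) :=
  if h : (Set.toFinite (shuffleOutcomes N M γ t pos)).toFinset.Nonempty then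
    PMF.uniformOfFinset _ h
  else PMF.pure pos

/-- The joint law of the placements at the times `0, …, t` (a trajectory `x` has placement `x s` after
`s` rounds; entries beyond `t` are irrelevant). Initially each token is at the node that created it,
and the rounds use fresh randomness. -/
def placementLaw (N : ℕ) (M : ℕ → SimpleGraph V) (γ : ℕ) : ℕ → PMF (ℕ → V × Fin γ → V)
  | 0 => PMF.pure fun _ j => j.1
  | t + 1 => (placementLaw N M γ t).bind fun x =>
      (shuffleStep N M γ (t + 1) (x t)).map fun pos => Function.update x (t + 1) pos

/-! ### Broadcast part and update part -/

/-- The variables of a node: the counter `cnt`, the pair `(dom, est)` that is broadcast, and the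
current guess `plu` of the plurality opinion. -/
structure Vars (k : ℕ) where
  cnt : ℕ
  dom : Fin k
  est : ℕ
  plu : Fin k

/-- The multiset of labels of the tokens held by `u`; a token is labeled with the initial opinion of
the node that created it. -/
def heldLabels {γ k : ℕ} (o : V → Fin k) (pos : V × Fin γ → V) (u : V) : Multiset (Fin k) :=
  (Set.toFinite {j | pos j = u}).toFinset.val.map fun j => o j.1

/-- `u` and `v` can communicate in round `t` (a node can communicate with itself). -/
def CanTalk (M : ℕ → SimpleGraph V) (t : ℕ) (u v : V) : Prop := v = u ∨ (M t).Adj u v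

/-- `s` (where `s t u` are the variables of node `u` after `t` rounds) is a run of the protocol
`Shuffle` for the trajectory `x` of token placements. Ties in the broadcast part may be broken in any
way, and the initial value of `plu` is arbitrary. -/
structure IsRun {γ k : ℕ} (N : ℕ) (M : ℕ → SimpleGraph V) (o : V → Fin k)
    (x : ℕ → V × Fin γ → V) (s : ℕ → V → Vars k) : Prop where
  init : ∀ u, (s 0 u).cnt = 0 ∧ (s 0 u).dom = o u ∧ (s 0 u).est = 0
  step : ∀ t < N, ∀ u, ∃ w, CanTalk M (t + 1) u w ∧
    (∀ w', CanTalk M (t + 1) u w' → (s t w').est ≤ (s t w).est) ∧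
    (¬ tmix N M ∣ t + 1 →
      s (t + 1) u = ⟨(s t u).cnt, (s t w).dom, (s t w).est, (s t u).plu⟩) ∧
    (tmix N M ∣ t + 1 →
      s (t + 1) u = ⟨(s t u).cnt + (heldLabels o (x (t + 1)) u).count (o u), o u,
        (s t u).cnt + (heldLabels o (x (t + 1)) u).count (o u), (s t w).dom⟩)

/-! ### Memory -/

/-- Everything a node stores: the labels of its tokens, its own opinion, its variables, and the
number of rounds executed so far. -/
structure NodeState (k : ℕ) where
  tokens : Multiset (Fin k)
  own : Fin k
  vars : Vars k
  clock : ℕ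

/-- The states in which some node can be at some time during the first `R` rounds, over all initial
opinions, all random choices and all ways to break ties. -/
def nodeStates (N : ℕ) (M : ℕ → SimpleGraph V) (γ k R : ℕ) : Set (NodeState k) :=
  {σ | ∃ (o : V → Fin k) (x : ℕ → V × Fin γ → V) (s : ℕ → V → Vars k) (t : ℕ) (u : V),
    x ∈ (placementLaw N M γ N).support ∧ IsRun N M o x s ∧ t ≤ R ∧ t ≤ N ∧
    σ = ⟨heldLabels o (x t) u, o u, s t u, t⟩}

/-- `b` bits of memory suffice to store the elements of `S`. -/
def FitsInBits {k : ℕ} (S : Set (NodeState k)) (b : ℕ) : Prop :=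
  ∃ enc : NodeState k → (Fin b → Bool), Set.InjOn enc S

end

end Plurality

open Plurality

/-! Each counter is a sum of indicators "this token is at this node at this update". Along time, a
window of `tmix` rounds makes every token almost uniform, given the past. Across tokens there is no
independence, because a node sends its tokens without replacement; the dependence is negative,
however. By AM-GM and exchangeability (`sum_mul_prod_le_of_swap`), the expectation of a product of
nonnegative weights over a set of tokens is at most its value for independent walks
(`sum_prod_le_of_exchangeable`). Backward induction over rounds extends this to a window
(`expect_placementLaw_window_le`), while a factor depending on the past is carried along.

With weight `exp a` at a fixed node and 1 elsewhere this bounds the moment generating function of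
the counter (`expect_exp_visits_le`), so Chernoff bounds hold in both directions. After `m` updates
a counter is on the wrong side of the threshold midway between the plurality share and that share
minus the bias with probability at most `exp (-(γ α² / 64)) ^ m`. Summing over nodes and over all
late updates is a geometric series, so with high probability all late counters are separated at once
(`plurality_probability_ge`).

The rest is deterministic. An entry of a mixing window differs from 1/n by less than 1/n, hence is
positive, hence comes from a path that respects time; so the largest estimate reaches everybody
within one phase (`IsRun.update_step`). If the counters are separated, its owner supports `p`
(`IsRun.plu_eq_plurality`).

For the memory bound the states are counted (`nodeStates_fitsInBits`); the factor 4 in front of the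
logarithm leaves room for all constants (`clog_states_le`). -/

namespace Plurality

open Matrix

noncomputable section

/-! ### Negative dependence of sampling without replacement -/

section Exchangeable

variable {ι W : Type*} [DecidableEq ι]

lemma sum_comp_swap (S : Finset (ι → W)) {i j : ι}
    (hS : ∀ f ∈ S, f ∘ Equiv.swap i j ∈ S) (φ : (ι → W) → ℝ) :
    ∑ f ∈ S, φ (f ∘ Equiv.swap i j) = ∑ f ∈ S, φ f := by
  have hinv : ∀ f : ι → W, (f ∘ Equiv.swap i j) ∘ Equiv.swap i j = f := fun f => by
    funext l; simp
  exact Finset.sum_nbij' (fun f => f ∘ Equiv.swap i j) (fun f => f ∘ Equiv.swap i j) hS hS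
    (fun f _ => hinv f) (fun f _ => hinv f) (fun _ _ => rfl)

/-- Moving the extra factor from `i ∉ J` onto `j` can only help. For `j ∉ J` the swap gives
equality; for `j ∈ J` the right side contains the square of `w (f j)`, and `2ab ≤ a² + b²` applies,
the two squares having equal sums by the swap. -/
lemma sum_mul_prod_le_of_swap (S : Finset (ι → W)) {i j : ι}
    (hS : ∀ f ∈ S, f ∘ Equiv.swap i j ∈ S) (w : W → ℝ) (hw : ∀ v, 0 ≤ w v)
    (J : Finset ι) (hi : i ∉ J) :
    ∑ f ∈ S, w (f i) * ∏ l ∈ J, w (f l) ≤ ∑ f ∈ S, w (f j) * ∏ l ∈ J, w (f l) := by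
  have hfix : ∀ (f : ι → W) (A : Finset ι), i ∉ A → j ∉ A →
      ∏ l ∈ A, w ((f ∘ Equiv.swap i j) l) = ∏ l ∈ A, w (f l) := by
    intro f A hiA hjA
    refine Finset.prod_congr rfl fun l hl => ?_
    have h1 : l ≠ i := fun h => hiA (h ▸ hl)
    have h2 : l ≠ j := fun h => hjA (h ▸ hl)
    simp [Equiv.swap_apply_of_ne_of_ne h1 h2]
  by_cases hj : j ∈ J
  · have hiE : i ∉ J.erase j := fun h => hi (Finset.mem_of_mem_erase h)
    have hsplit : ∀ f : ι → W, ∏ l ∈ J, w (f l) = w (f j) * ∏ l ∈ J.erase j, w (f l) :=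
      fun f => (Finset.mul_prod_erase J (fun l => w (f l)) hj).symm
    have hsq : ∑ f ∈ S, w (f i) ^ 2 * ∏ l ∈ J.erase j, w (f l)
        = ∑ f ∈ S, w (f j) ^ 2 * ∏ l ∈ J.erase j, w (f l) := by
      rw [← sum_comp_swap S hS]
      refine Finset.sum_congr rfl fun f _ => ?_
      rw [hfix f _ hiE (Finset.notMem_erase j J)]
      simp
    have hle : ∑ f ∈ S, 2 * (w (f i) * ∏ l ∈ J, w (f l))
        ≤ ∑ f ∈ S, (w (f i) ^ 2 * ∏ l ∈ J.erase j, w (f l)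
          + w (f j) ^ 2 * ∏ l ∈ J.erase j, w (f l)) := by
      refine Finset.sum_le_sum fun f _ => ?_
      rw [hsplit f]
      have h0 : 0 ≤ ∏ l ∈ J.erase j, w (f l) := Finset.prod_nonneg fun l _ => hw _
      nlinarith [mul_nonneg (sq_nonneg (w (f i) - w (f j))) h0]
    rw [Finset.sum_add_distrib, hsq, ← Finset.mul_sum] at hle
    have hR : ∑ f ∈ S, w (f j) * ∏ l ∈ J, w (f l)
        = ∑ f ∈ S, w (f j) ^ 2 * ∏ l ∈ J.erase j, w (f l) :=
      Finset.sum_congr rfl fun f _ => by rw [hsplit f]; ring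
    rw [hR]; linarith
  · rw [← sum_comp_swap S hS]
    refine le_of_eq (Finset.sum_congr rfl fun f _ => ?_)
    rw [hfix f _ hi hj]
    simp

/-- Sampling without replacement: products of nonnegative weights have at most the expectation
that they would have under independent sampling. -/
lemma sum_prod_le_of_exchangeable [Fintype ι] [DecidableEq W] (S : Finset (ι → W)) (pos : ι → W)
    (hS : ∀ f ∈ S, ∀ i j, pos i = pos j → f ∘ Equiv.swap i j ∈ S)
    (w g : W → ℝ) (hw : ∀ v, 0 ≤ w v) (hg0 : ∀ v, 0 ≤ g v)
    (hg : ∀ f ∈ S, ∀ u, ∑ j with pos j = u, w (f j)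
      = (Finset.univ.filter fun j => pos j = u).card * g u) (J : Finset ι) :
    ∑ f ∈ S, ∏ j ∈ J, w (f j) ≤ S.card * ∏ j ∈ J, g (pos j) := by
  induction J using Finset.induction_on with
  | empty => simp
  | insert i J hi ih =>
    simp only [Finset.prod_insert hi]
    set B := Finset.univ.filter fun j => pos j = pos i with hB
    have hpos : (0 : ℝ) < B.card := by
      exact_mod_cast Finset.card_pos.2 ⟨i, by simp [hB]⟩
    -- Average over all tokens `j` that start at the same node as `i`: the sum of their weights is
    -- the same for every outcome, so it factors out.
    have h1 : (B.card : ℝ) * ∑ f ∈ S, w (f i) * ∏ l ∈ J, w (f l)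
        ≤ B.card * (g (pos i) * ∑ f ∈ S, ∏ l ∈ J, w (f l)) := by
      calc (B.card : ℝ) * ∑ f ∈ S, w (f i) * ∏ l ∈ J, w (f l)
          = ∑ j ∈ B, ∑ f ∈ S, w (f i) * ∏ l ∈ J, w (f l) := by simp
        _ ≤ ∑ j ∈ B, ∑ f ∈ S, w (f j) * ∏ l ∈ J, w (f l) := by
            refine Finset.sum_le_sum fun j hj => ?_
            have hj' : pos j = pos i := by simpa [hB] using hj
            exact sum_mul_prod_le_of_swap S (fun f hf => hS f hf i j hj'.symm) w hw J hi
        _ = ∑ f ∈ S, (∑ j ∈ B, w (f j)) * ∏ l ∈ J, w (f l) := by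
            rw [Finset.sum_comm]; simp [Finset.sum_mul]
        _ = B.card * (g (pos i) * ∑ f ∈ S, ∏ l ∈ J, w (f l)) := by
            rw [Finset.mul_sum, Finset.mul_sum]
            refine Finset.sum_congr rfl fun f hf => ?_
            rw [hg f hf (pos i)]; ring
    have h2 := le_of_mul_le_mul_left h1 hpos
    calc _ ≤ _ := h2
      _ ≤ g (pos i) * (S.card * ∏ j ∈ J, g (pos j)) := mul_le_mul_of_nonneg_left ih (hg0 _)
      _ = _ := by ring

end Exchangeable

/-! ### The transition matrices are symmetric and stochastic -/

section Transition

variable {V : Type*} [Fintype V] {N : ℕ} {M : ℕ → SimpleGraph V}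

lemma activeDegree_le_max {t : ℕ} (ht : t ∈ Finset.Icc 1 N) (u : V) :
    activeDegree M t u ≤ maxActiveDegree N M :=
  (Finset.le_sup (f := fun u => activeDegree M t u) (Finset.mem_univ u)).trans
    (Finset.le_sup (f := fun t => Finset.univ.sup fun u => activeDegree M t u) ht)

lemma transition_symm (t : ℕ) (u v : V) : transition N M t u v = transition N M t v u := by
  unfold transition
  by_cases h : u = v
  · subst h; rfl
  · rw [if_neg h, if_neg (Ne.symm h)]
    by_cases hA : (M t).Adj u v
    · rw [if_pos hA, if_pos hA.symm]
    · rw [if_neg hA, if_neg fun h' => hA h'.symm]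

lemma transition_nonneg {t : ℕ} (ht : t ∈ Finset.Icc 1 N) (u v : V) :
    0 ≤ transition N M t u v := by
  unfold transition
  split_ifs
  · have h : (activeDegree M t u : ℝ) ≤ maxActiveDegree N M := by
      exact_mod_cast activeDegree_le_max ht u
    have h0 : (0 : ℝ) ≤ activeDegree M t u := by positivity
    rw [sub_nonneg]
    exact div_le_one_of_le₀ (by linarith) (by positivity)
  · positivity
  · exact le_rfl

lemma sum_transition (t : ℕ) (u : V) : ∑ v, transition N M t u v = 1 := by
  classical
  rw [← Finset.add_sum_erase _ _ (Finset.mem_univ u)]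
  have h1 : ∑ v ∈ Finset.univ.erase u, transition N M t u v
      = ∑ v ∈ Finset.univ.erase u,
        if (M t).Adj u v then 1 / (2 * (maxActiveDegree N M : ℝ)) else 0 := by
    refine Finset.sum_congr rfl fun v hv => ?_
    have : u ≠ v := (Finset.ne_of_mem_erase hv).symm
    simp [transition, this]
  have h2 : ((Finset.univ.erase u).filter fun v => (M t).Adj u v).card = activeDegree M t u := by
    unfold activeDegree
    rw [Set.ncard_eq_toFinset_card']
    congr 1
    ext v
    simp only [Finset.mem_filter, Finset.mem_erase, Finset.mem_univ, and_true, Set.mem_toFinset,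
      SimpleGraph.mem_neighborSet, and_iff_right_iff_imp]
    exact fun h => h.ne'
  rw [h1, ← Finset.sum_filter, Finset.sum_const, h2]
  simp [transition]
  ring

lemma sum_transition_left (t : ℕ) (v : V) : ∑ u, transition N M t u v = 1 := by
  simp_rw [transition_symm (N := N) (M := M) t _ v, sum_transition]

lemma exists_nat_eq_transition_mul {γ : ℕ} (hΔ : 0 < maxActiveDegree N M)
    (hγ : 2 * maxActiveDegree N M ∣ γ) {t : ℕ} (ht : t ∈ Finset.Icc 1 N) (u v : V) :
    ∃ m : ℕ, (m : ℝ) = transition N M t u v * γ := by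
  obtain ⟨r, rfl⟩ := hγ
  have hd := activeDegree_le_max (M := M) ht u
  have hΔ' : (maxActiveDegree N M : ℝ) ≠ 0 := by exact_mod_cast hΔ.ne'
  unfold transition
  split_ifs
  · refine ⟨(2 * maxActiveDegree N M - activeDegree M t u) * r, ?_⟩
    push_cast [Nat.cast_sub (show activeDegree M t u ≤ 2 * maxActiveDegree N M by omega)]
    field_simp
  · refine ⟨r, ?_⟩
    push_cast
    field_simp
  · exact ⟨0, by simp⟩

end Transition

/-! ### Outcomes of one shuffle round -/

section Shuffle

variable {V : Type*} {N γ : ℕ}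

/-- Each node holds exactly `γ` tokens. -/
def Balanced (pos : V × Fin γ → V) : Prop := ∀ u, {j | pos j = u}.ncard = γ

lemma balanced_fst : Balanced (fun j : V × Fin γ => j.1) := by
  intro u
  have h : {j : V × Fin γ | j.1 = u} = (fun i => (u, i)) '' (Set.univ : Set (Fin γ)) := by
    ext ⟨a, b⟩; simp [eq_comm]
  rw [h, Set.ncard_image_of_injective _ (fun a b hab => by simpa using hab), Set.ncard_univ]
  simp

variable [Fintype V] {M : ℕ → SimpleGraph V}

lemma sum_fiber_eq_of_mem_shuffleOutcomes [DecidableEq V] {t : ℕ} {pos pos' : V × Fin γ → V}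
    (h : pos' ∈ shuffleOutcomes N M γ t pos) (w : V → ℝ) (u : V) :
    ∑ j with pos j = u, w (pos' j) = γ * (transition N M t *ᵥ w) u := by
  rw [← Finset.sum_fiberwise _ pos']
  simp only [Matrix.mulVec, dotProduct, Finset.mul_sum]
  refine Finset.sum_congr rfl fun v _ => ?_
  have h1 := h u v
  rw [Set.ncard_eq_toFinset_card', Set.toFinset_ofPred] at h1
  rw [Finset.sum_congr rfl (g := fun _ => w v)
    (fun j hj => by rw [(Finset.mem_filter.1 hj).2]), Finset.sum_const, Finset.filter_filter,
    nsmul_eq_mul, h1]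
  ring

/-- Column sums of the transition matrix are 1, so a node receives as many tokens as it should hold.
Only the prescribed transfer counts are used. -/
lemma balanced_of_mem_shuffleOutcomes {t : ℕ} {pos pos' : V × Fin γ → V}
    (h : pos' ∈ shuffleOutcomes N M γ t pos) : Balanced pos' := by
  classical
  intro v
  have h1 : ((Finset.univ.filter fun j => pos' j = v).card : ℝ)
      = ∑ u, ∑ j with pos j = u, if pos' j = v then (1 : ℝ) else 0 := by
    rw [Finset.sum_fiberwise Finset.univ pos fun j => if pos' j = v then (1 : ℝ) else 0]; simp
  have h2 : ∀ u, ∑ j with pos j = u, (if pos' j = v then (1 : ℝ) else 0)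
      = γ * transition N M t u v := by
    intro u
    rw [sum_fiber_eq_of_mem_shuffleOutcomes h (fun a => if a = v then 1 else 0)]
    simp [Matrix.mulVec, dotProduct]
  simp only [h2, ← Finset.mul_sum, sum_transition_left, mul_one] at h1
  rw [Set.ncard_eq_toFinset_card', Set.toFinset_ofPred]
  exact_mod_cast h1

lemma exists_map_with_fiber_card {A B : Type*} [Fintype A] [Fintype B] (m : B → ℕ)
    (h : Fintype.card A = ∑ b, m b) : ∃ f : A → B, ∀ b, {a | f a = b}.ncard = m b := by
  have e : A ≃ Σ b, Fin (m b) := Fintype.equivOfCardEq (by simp [h])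
  refine ⟨fun a => (e a).1, fun b => ?_⟩
  have h1 : {a | (e a).1 = b} = e.symm '' ((fun i => (⟨b, i⟩ : Σ b, Fin (m b))) '' Set.univ) := by
    ext a
    simp only [Set.mem_ofPred_eq, Set.image_univ, Set.mem_image, Set.mem_range]
    constructor
    · rintro rfl
      exact ⟨e a, ⟨(e a).2, rfl⟩, by simp⟩
    · rintro ⟨_, ⟨i, rfl⟩, rfl⟩
      simp
  rw [h1, Set.ncard_image_of_injective _ e.symm.injective,
    Set.ncard_image_of_injective _ (fun a c hac => by simpa using hac), Set.ncard_univ]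
  simp

/-- This rules out the fallback branch of `shuffleStep`: the prescribed transfer counts are integers
since `2Δ ∣ γ`, and each row of them sums to `γ`. -/
lemma shuffleOutcomes_nonempty (hΔ : 0 < maxActiveDegree N M)
    (hγ : 2 * maxActiveDegree N M ∣ γ) {t : ℕ} (ht : t ∈ Finset.Icc 1 N)
    {pos : V × Fin γ → V} (hpos : Balanced pos) : (shuffleOutcomes N M γ t pos).Nonempty := by
  classical
  choose m hm using fun u v => exists_nat_eq_transition_mul (M := M) hΔ hγ ht u v
  have hf : ∀ u, ∃ f : {j // pos j = u} → V, ∀ v, {a | f a = v}.ncard = m u v := by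
    intro u
    refine exists_map_with_fiber_card (m u) ?_
    have h1 : Fintype.card {j // pos j = u} = γ := by
      rw [← Nat.card_eq_fintype_card]
      exact hpos u
    rw [h1]
    have h2 : ((∑ v, m u v : ℕ) : ℝ) = γ := by
      push_cast
      simp only [hm, ← Finset.sum_mul, sum_transition, one_mul]
    exact_mod_cast h2.symm
  choose f hf using hf
  refine ⟨fun j => f (pos j) ⟨j, rfl⟩, fun u v => ?_⟩
  rw [← hm, ← hf u v]
  congr 1
  rw [← Set.ncard_image_of_injective _ Subtype.val_injective]
  congr 1
  ext j
  simp only [Set.mem_ofPred_eq, Set.mem_image, Subtype.exists, exists_and_right, exists_eq_right]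
  constructor
  · rintro ⟨rfl, h⟩
    exact ⟨rfl, h⟩
  · rintro ⟨rfl, h⟩
    exact ⟨rfl, h⟩

/-- The exchangeability that feeds `sum_prod_le_of_exchangeable`: exchanging the destinations of two
tokens from one node changes no transfer count. -/
lemma comp_swap_mem_shuffleOutcomes [DecidableEq V] {t : ℕ} {pos pos' : V × Fin γ → V}
    (h : pos' ∈ shuffleOutcomes N M γ t pos) {i j : V × Fin γ} (hij : pos i = pos j) :
    pos' ∘ Equiv.swap i j ∈ shuffleOutcomes N M γ t pos := by
  intro u v
  rw [← h u v]
  norm_cast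
  refine (Set.ncard_image_of_injective _ (Equiv.swap i j).injective).symm.trans ?_
  have hl : ∀ l, pos (Equiv.swap i j l) = pos l := by
    intro l
    rcases eq_or_ne l i with rfl | h1
    · simp [hij]
    · rcases eq_or_ne l j with rfl | h2
      · simp [hij]
      · rw [Equiv.swap_apply_of_ne_of_ne h1 h2]
  congr 1
  ext l
  constructor
  · rintro ⟨a, ⟨ha, hb⟩, rfl⟩
    exact ⟨(hl a).trans ha, hb⟩
  · rintro ⟨ha, hb⟩
    exact ⟨Equiv.swap i j l, ⟨(hl l).trans ha, by simpa using hb⟩, by simp⟩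

end Shuffle

/-! ### Expectations with values in `ℝ≥0∞` -/

section Expectation

open scoped ENNReal

/-- The expectation of an extended nonnegative function. -/
def expect {α : Type*} (p : PMF α) (f : α → ℝ≥0∞) : ℝ≥0∞ := ∑' x, p x * f x

variable {α β : Type*}

lemma expect_mono_support {p : PMF α} {f g : α → ℝ≥0∞} (h : ∀ x ∈ p.support, f x ≤ g x) :
    expect p f ≤ expect p g := by
  refine ENNReal.tsum_le_tsum fun x => ?_
  by_cases hx : p x = 0
  · simp [hx]
  · exact mul_le_mul_right (h x ((PMF.mem_support_iff _ _).2 hx)) _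

lemma expect_bind (p : PMF α) (f : α → PMF β) (g : β → ℝ≥0∞) :
    expect (p.bind f) g = expect p fun a => expect (f a) g := by
  simp only [expect, PMF.bind_apply, ← ENNReal.tsum_mul_right, ← ENNReal.tsum_mul_left]
  rw [ENNReal.tsum_comm]
  simp only [mul_assoc]

lemma expect_pure (a : α) (g : α → ℝ≥0∞) : expect (PMF.pure a) g = g a := by
  classical
  unfold expect
  rw [tsum_eq_single a]
  · simp
  · intro b hb
    simp [hb]

lemma expect_map (p : PMF α) (f : α → β) (g : β → ℝ≥0∞) :
    expect (p.map f) g = expect p fun a => g (f a) := by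
  rw [PMF.map, expect_bind]
  simp [expect_pure]

lemma expect_const_mul (p : PMF α) (c : ℝ≥0∞) (g : α → ℝ≥0∞) :
    expect p (fun a => c * g a) = c * expect p g := by
  simp only [expect, ← ENNReal.tsum_mul_left, mul_left_comm]

lemma expect_one (p : PMF α) : expect p (fun _ => 1) = 1 := by
  simp [expect, p.tsum_coe]

lemma expect_uniformOfFinset (s : Finset α) (hs : s.Nonempty) (g : α → ℝ≥0∞) :
    expect (PMF.uniformOfFinset s hs) g = (s.card : ℝ≥0∞)⁻¹ * ∑ a ∈ s, g a := by
  classical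
  unfold expect
  rw [tsum_eq_sum (s := s) (fun a ha => by simp [ha]), Finset.mul_sum]
  exact Finset.sum_congr rfl fun a ha => by simp [ha]

lemma toOuterMeasure_le_expect (p : PMF α) (s : Set α) (g : α → ℝ≥0∞)
    (h : ∀ x ∈ s, 1 ≤ g x) : p.toOuterMeasure s ≤ expect p g := by
  rw [PMF.toOuterMeasure_apply]
  refine ENNReal.tsum_le_tsum fun x => ?_
  by_cases hx : x ∈ s
  · rw [Set.indicator_of_mem hx]
    calc p x = p x * 1 := (mul_one _).symm
      _ ≤ _ := mul_le_mul_right (h x hx) _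
  · simp [hx]

end Expectation

/-! ### Products over tokens along a window of rounds -/

section Law

open scoped ENNReal

variable {V : Type*} [Fintype V] {N γ : ℕ} {M : ℕ → SimpleGraph V}

lemma expect_shuffleStep_le (hΔ : 0 < maxActiveDegree N M)
    (hγ : 2 * maxActiveDegree N M ∣ γ) {t : ℕ} (ht : t ∈ Finset.Icc 1 N)
    {pos : V × Fin γ → V} (hpos : Balanced pos) (h : V → ℝ) (hh : ∀ v, 0 ≤ h v)
    (J : Finset (V × Fin γ)) :
    expect (shuffleStep N M γ t pos) (fun pos' => ENNReal.ofReal (∏ j ∈ J, h (pos' j)))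
      ≤ ENNReal.ofReal (∏ j ∈ J, (transition N M t *ᵥ h) (pos j)) := by
  classical
  have hne : (Set.toFinite (shuffleOutcomes N M γ t pos)).toFinset.Nonempty := by
    simpa using shuffleOutcomes_nonempty hΔ hγ ht hpos
  rw [shuffleStep, dif_pos hne, expect_uniformOfFinset]
  set S := (Set.toFinite (shuffleOutcomes N M γ t pos)).toFinset with hS
  have hmem : ∀ f, f ∈ S ↔ f ∈ shuffleOutcomes N M γ t pos := fun f => by simp [hS]
  have key := sum_prod_le_of_exchangeable S pos
    (fun f hf i j hij => (hmem _).2 (comp_swap_mem_shuffleOutcomes ((hmem f).1 hf) hij))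
    h (transition N M t *ᵥ h) hh
    (fun v => Finset.sum_nonneg fun a _ => mul_nonneg (transition_nonneg ht v a) (hh a))
    (fun f hf u => by
      rw [sum_fiber_eq_of_mem_shuffleOutcomes ((hmem f).1 hf) h u]
      have := hpos u
      rw [Set.ncard_eq_toFinset_card', Set.toFinset_ofPred] at this
      rw [this]) J
  rw [← ENNReal.ofReal_sum_of_nonneg fun f _ => Finset.prod_nonneg fun j _ => hh _]
  have hc : (S.card : ℝ≥0∞) ≠ 0 := by exact_mod_cast hne.card_pos.ne'
  calc (S.card : ℝ≥0∞)⁻¹ * ENNReal.ofReal (∑ f ∈ S, ∏ j ∈ J, h (f j))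
      ≤ (S.card : ℝ≥0∞)⁻¹ * ENNReal.ofReal (S.card * ∏ j ∈ J, (transition N M t *ᵥ h) (pos j)) :=
        mul_le_mul_right (ENNReal.ofReal_le_ofReal key) _
    _ = _ := by
        rw [ENNReal.ofReal_mul (by positivity), ENNReal.ofReal_natCast, ← mul_assoc,
          ENNReal.inv_mul_cancel hc (ENNReal.natCast_ne_top _), one_mul]

lemma balanced_of_mem_support_shuffleStep {t : ℕ} {pos pos' : V × Fin γ → V}
    (hpos : Balanced pos) (h : pos' ∈ (shuffleStep N M γ t pos).support) : Balanced pos' := by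
  unfold shuffleStep at h
  split_ifs at h with hne
  · rw [PMF.support_uniformOfFinset] at h
    exact balanced_of_mem_shuffleOutcomes (by simpa using h)
  · rw [PMF.support_pure, Set.mem_singleton_iff] at h
    rwa [h]

lemma balanced_of_mem_support_placementLaw {t : ℕ} :
    ∀ {x : ℕ → V × Fin γ → V}, x ∈ (placementLaw N M γ t).support → ∀ s ≤ t, Balanced (x s) := by
  induction t with
  | zero =>
    intro x hx s _
    rw [placementLaw, PMF.support_pure, Set.mem_singleton_iff] at hx
    rw [hx]; exact balanced_fst
  | succ t ih =>
    intro x hx s hs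
    rw [placementLaw, PMF.mem_support_bind_iff] at hx
    obtain ⟨y, hy, hx⟩ := hx
    rw [PMF.mem_support_map_iff] at hx
    obtain ⟨pos, hp, rfl⟩ := hx
    rcases Nat.lt_or_eq_of_le hs with hs' | rfl
    · rw [Function.update_of_ne hs'.ne]
      exact ih hy s (by omega)
    · rw [Function.update_self]
      exact balanced_of_mem_support_shuffleStep (ih hy t le_rfl) hp

lemma windowProd_zero (t : ℕ) [DecidableEq V] : windowProd N M t 0 = 1 := by
  simp only [windowProd, List.range_zero, List.map_nil, List.prod_nil]
  congr!

lemma windowProd_succ (t ℓ : ℕ) :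
    windowProd N M t (ℓ + 1) = windowProd N M t ℓ * transition N M (t + ℓ) := by
  classical
  simp [windowProd, List.range_succ]

/-- The functional `G` of trajectories depends only on the placements up to time `t`. -/
def DependsUpTo {A B : Type*} (t : ℕ) (G : (ℕ → A) → B) : Prop :=
  ∀ x s a, t < s → G (Function.update x s a) = G x

/-- Peel off the last round: its conditional expectation replaces `h` by the transition matrix
applied to `h`, and the induction goes on with this new weight. The past factor `G` makes it
possible to chain windows. -/
lemma expect_placementLaw_window_le (hΔ : 0 < maxActiveDegree N M)
    (hγ : 2 * maxActiveDegree N M ∣ γ) {t : ℕ} (J : Finset (V × Fin γ))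
    (G : (ℕ → V × Fin γ → V) → ℝ≥0∞) (hG : DependsUpTo t G) {ℓ : ℕ} (hℓ : t + ℓ ≤ N) :
    ∀ (h : V → ℝ), (∀ v, 0 ≤ h v) →
    expect (placementLaw N M γ (t + ℓ))
        (fun x => G x * ENNReal.ofReal (∏ j ∈ J, h (x (t + ℓ) j)))
      ≤ expect (placementLaw N M γ t)
        (fun x => G x * ENNReal.ofReal (∏ j ∈ J, (windowProd N M (t + 1) ℓ *ᵥ h) (x t j))) := by
  classical
  induction ℓ with
  | zero =>
    intro h hh
    simp [windowProd_zero]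
  | succ ℓ ih =>
    intro h hh
    have ht : t + ℓ + 1 ∈ Finset.Icc 1 N := Finset.mem_Icc.2 ⟨by omega, by omega⟩
    rw [← add_assoc, placementLaw, expect_bind]
    refine le_trans (expect_mono_support (g := fun x => G x * ENNReal.ofReal
      (∏ j ∈ J, (transition N M (t + ℓ + 1) *ᵥ h) (x (t + ℓ) j))) fun x hx => ?_) ?_
    · rw [expect_map]
      simp only [Function.update_self, hG x _ _ (show t < t + ℓ + 1 by omega)]
      rw [expect_const_mul]
      exact mul_le_mul_right (expect_shuffleStep_le hΔ hγ ht
        (balanced_of_mem_support_placementLaw hx _ le_rfl) h hh J) _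
    · refine (ih (by omega) (transition N M (t + ℓ + 1) *ᵥ h) fun v => Finset.sum_nonneg fun a _ =>
        mul_nonneg (transition_nonneg ht v a) (hh a)).trans_eq ?_
      rw [windowProd_succ, Matrix.mulVec_mulVec, show t + 1 + ℓ = t + ℓ + 1 by omega]

end Law

/-! ### Entries of a mixing window -/

section Smoothing

variable {V : Type*} [Fintype V] {N : ℕ} {M : ℕ → SimpleGraph V}

lemma windowProd_nonneg {t : ℕ} (ht : 1 ≤ t) {ℓ : ℕ} (hℓ : t + ℓ ≤ N + 1) (u v : V) :
    0 ≤ windowProd N M t ℓ u v := by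
  classical
  induction ℓ generalizing v with
  | zero => rw [windowProd_zero, Matrix.one_apply]; split_ifs <;> norm_num
  | succ ℓ ih =>
    rw [windowProd_succ, Matrix.mul_apply]
    exact Finset.sum_nonneg fun a _ => mul_nonneg (ih (by omega) a)
      (transition_nonneg (Finset.mem_Icc.2 ⟨by omega, by omega⟩) a v)

lemma sum_windowProd (t ℓ : ℕ) (u : V) : ∑ v, windowProd N M t ℓ u v = 1 := by
  classical
  induction ℓ with
  | zero => simp [windowProd_zero, Matrix.one_apply]
  | succ ℓ ih =>
    simp only [windowProd_succ, Matrix.mul_apply]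
    rw [Finset.sum_comm]
    simp [← Finset.mul_sum, sum_transition, ih]

/-- Smoothing of a unit vector bounds the spread of a row; the row sums to 1, so its mean `1/n` lies
between the minimum and the maximum. -/
lemma abs_windowProd_sub_le {t ℓ : ℕ} {ε : ℝ} (h : IsSmoothing N M t ℓ ε) (u v : V) :
    |windowProd N M t ℓ u v - 1 / Fintype.card V| ≤ ε := by
  classical
  have hn : (0 : ℝ) < Fintype.card V := by exact_mod_cast Fintype.card_pos_iff.2 ⟨u⟩
  have h1 := h (Pi.single u 1)
    (fun v => by by_cases hv : v = u <;> simp [hv])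
    (by rw [Pi.norm_single, norm_one])
  rw [Matrix.single_one_vecMul] at h1
  unfold disc at h1
  have hrow : (windowProd N M t ℓ).row u = fun v => windowProd N M t ℓ u v := rfl
  rw [hrow] at h1
  set f : V → ℝ := fun v => windowProd N M t ℓ u v with hf
  have hsup : ∀ v, f v ≤ ⨆ v, f v := le_ciSup (Set.finite_range f).bddAbove
  have hinf : ∀ v, ⨅ v, f v ≤ f v := ciInf_le (Set.finite_range f).bddBelow
  have hsum : ∑ v, f v = 1 := sum_windowProd t ℓ u
  have h2 : 1 / (Fintype.card V : ℝ) ≤ ⨆ v, f v := by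
    rw [div_le_iff₀ hn, ← hsum]
    calc _ ≤ ∑ _v : V, ⨆ v, f v := Finset.sum_le_sum fun v _ => hsup v
      _ = _ := by simp [mul_comm]
  have h3 : ⨅ v, f v ≤ 1 / (Fintype.card V : ℝ) := by
    rw [le_div_iff₀ hn, ← hsum]
    calc _ = ∑ _v : V, ⨅ v, f v := by simp [mul_comm]
      _ ≤ _ := Finset.sum_le_sum fun v _ => hinf v
  have h4 := hsup v
  have h5 := hinf v
  have h6 : windowProd N M t ℓ u v = f v := rfl
  rw [h6, abs_le]
  constructor <;> linarith

/-- The infimum is attained because the set is nonempty: no window of length `N + 1` fits, so that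
length qualifies vacuously. -/
lemma mixingTime_spec (N : ℕ) (M : ℕ → SimpleGraph V) (ε : ℝ) :
    ∀ t, 1 ≤ t → t + mixingTime N M ε ≤ N + 1 → IsSmoothing N M t (mixingTime N M ε) ε :=
  Nat.sInf_mem (s := {ℓ | ∀ t, 1 ≤ t → t + ℓ ≤ N + 1 → IsSmoothing N M t ℓ ε})
    ⟨N + 1, fun t _ _ => by omega⟩

lemma abs_windowProd_tmix_sub_le {t : ℕ} (ht : 1 ≤ t) (htN : t + tmix N M ≤ N + 1) (u v : V) :
    |windowProd N M t (tmix N M) u v - 1 / Fintype.card V| ≤ 1 / (Fintype.card V : ℝ) ^ 5 :=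
  abs_windowProd_sub_le (mixingTime_spec N M _ t ht htN) u v

/-- The empty product is the identity, whose diagonal is too far from `1/n`. -/
lemma tmix_pos (hV : 2 ≤ Fintype.card V) : 0 < tmix N M := by
  classical
  rw [Nat.pos_iff_ne_zero]
  intro h0
  obtain ⟨u, v, huv⟩ := Fintype.one_lt_card_iff.1 hV
  have hn : (2 : ℝ) ≤ Fintype.card V := by exact_mod_cast hV
  have h1 := abs_windowProd_tmix_sub_le (N := N) (M := M) le_rfl (by omega) u u
  rw [h0, windowProd_zero, Matrix.one_apply_eq] at h1
  have h2 : 1 / (Fintype.card V : ℝ) ≤ 1 / 2 := one_div_le_one_div_of_le (by norm_num) hn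
  have h3 : 1 / (Fintype.card V : ℝ) ^ 5 ≤ 1 / 2 ^ 5 :=
    one_div_le_one_div_of_le (by norm_num) (pow_le_pow_left₀ (by norm_num) hn 5)
  have h4 := le_abs_self (1 - 1 / (Fintype.card V : ℝ))
  norm_num at h2 h3 h4 h1
  linarith

lemma windowProd_tmix_pos (hV : 2 ≤ Fintype.card V) {t : ℕ} (ht : 1 ≤ t)
    (htN : t + tmix N M ≤ N + 1) (u v : V) : 0 < windowProd N M t (tmix N M) u v := by
  have hn : (2 : ℝ) ≤ Fintype.card V := by exact_mod_cast hV
  have h1 := (abs_le.1 (abs_windowProd_tmix_sub_le ht htN u v)).1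
  have h2 : 1 / (Fintype.card V : ℝ) ^ 5 < 1 / Fintype.card V := by
    apply one_div_lt_one_div_of_lt (by linarith)
    calc (Fintype.card V : ℝ) = (Fintype.card V : ℝ) ^ 1 := (pow_one _).symm
      _ < _ := pow_lt_pow_right₀ (by linarith) (by norm_num)
  linarith

end Smoothing

/-! ### Exponential moments and Chernoff exponents -/

section Tail

open scoped ENNReal

lemma expect_placementLaw_le_of_dependsUpTo {V : Type*} [Fintype V] {N γ : ℕ}
    {M : ℕ → SimpleGraph V} (hΔ : 0 < maxActiveDegree N M)
    (hγ : 2 * maxActiveDegree N M ∣ γ) {t : ℕ} (ht : t ≤ N)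
    {G : (ℕ → V × Fin γ → V) → ℝ≥0∞} (hG : DependsUpTo t G) :
    expect (placementLaw N M γ N) G ≤ expect (placementLaw N M γ t) G := by
  obtain ⟨ℓ, rfl⟩ := Nat.exists_eq_add_of_le ht
  -- With no tokens the product is 1, so the weight 0 plays no role.
  simpa using expect_placementLaw_window_le hΔ hγ ∅ G hG le_rfl (fun _ => 0) (fun _ => le_rfl)

variable {V : Type*} {N γ : ℕ}

variable [DecidableEq V]

/-- The number of times, among the times `τ, 2τ, …, mτ`, that tokens of `J` are at `u`. -/
def visits (J : Finset (V × Fin γ)) (x : ℕ → V × Fin γ → V) (τ m : ℕ) (u : V) : ℕ :=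
  ∑ r ∈ Finset.range m, (J.filter fun j => x ((r + 1) * τ) j = u).card

lemma dependsUpTo_visits (J : Finset (V × Fin γ)) (τ m : ℕ) (u : V) :
    DependsUpTo (m * τ) fun x => visits J x τ m u := by
  intro x s a hs
  refine Finset.sum_congr rfl fun r hr => ?_
  have h1 : (r + 1) * τ ≤ m * τ := Nat.mul_le_mul_right _ (Finset.mem_range.1 hr)
  rw [Function.update_of_ne (by omega)]

variable [Fintype V] {M : ℕ → SimpleGraph V}

lemma expect_exp_visits_le (hΔ : 0 < maxActiveDegree N M)
    (hγ : 2 * maxActiveDegree N M ∣ γ) {τ : ℕ} (J : Finset (V × Fin γ)) (u : V) (a K : ℝ)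
    (hK : ∀ t v, 1 ≤ t → t + τ ≤ N + 1 → 1 + (Real.exp a - 1) * windowProd N M t τ v u ≤ K)
    {m : ℕ} (hm : m * τ ≤ N) :
    expect (placementLaw N M γ (m * τ)) (fun x => ENNReal.ofReal (Real.exp (a * visits J x τ m u)))
      ≤ ENNReal.ofReal (K ^ (m * J.card)) := by
  induction m with
  | zero => simp [visits, expect_one]
  | succ m ih =>
    have hm' : m * τ + τ ≤ N := by rwa [← Nat.succ_mul]
    -- The product of these weights over `J` is `exp a` to the number of tokens at `u`, the factor
    -- which the new update contributes.
    set h : V → ℝ := fun v => if v = u then Real.exp a else 1 with hh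
    have hh0 : ∀ v, 0 ≤ h v := fun v => by
      simp only [hh]; split_ifs <;> positivity
    have hexp : ∀ x : ℕ → V × Fin γ → V,
        ENNReal.ofReal (Real.exp (a * visits J x τ (m + 1) u))
        = ENNReal.ofReal (Real.exp (a * visits J x τ m u))
          * ENNReal.ofReal (∏ j ∈ J, h (x (m * τ + τ) j)) := by
      intro x
      rw [← ENNReal.ofReal_mul (Real.exp_pos _).le]
      congr 1
      simp only [hh, visits, Finset.sum_range_succ, Nat.cast_add, mul_add, Real.exp_add,
        Finset.prod_ite, Finset.prod_const, one_pow, mul_one, Nat.succ_mul]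
      rw [← Real.exp_nat_mul, mul_comm a ((Finset.card _ : ℕ) : ℝ)]
    have hQ : ∀ v, (windowProd N M (m * τ + 1) τ *ᵥ h) v
        = 1 + (Real.exp a - 1) * windowProd N M (m * τ + 1) τ v u := by
      intro v
      have : ∀ w, windowProd N M (m * τ + 1) τ v w * h w
          = windowProd N M (m * τ + 1) τ v w
            + if w = u then (Real.exp a - 1) * windowProd N M (m * τ + 1) τ v w else 0 := by
        intro w
        simp only [hh]; split_ifs <;> ring
      simp only [Matrix.mulVec, dotProduct, this, Finset.sum_add_distrib, sum_windowProd]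
      simp
    have hQ0 : ∀ v, 0 ≤ (windowProd N M (m * τ + 1) τ *ᵥ h) v := fun v =>
      Finset.sum_nonneg fun w _ =>
        mul_nonneg (windowProd_nonneg (by omega) (by omega) v w) (hh0 w)
    have hK0 : 0 ≤ K := (hQ0 u).trans (by rw [hQ]; exact hK _ _ (by omega) (by omega))
    simp only [hexp]
    rw [Nat.succ_mul m τ]
    refine (expect_placementLaw_window_le hΔ hγ J _
      (fun x s b hs => by
        have := dependsUpTo_visits J τ m u x s b hs
        simp only at this
        rw [this]) hm' h hh0).trans ?_
    refine le_trans (expect_mono_support (g := fun x => ENNReal.ofReal (K ^ J.card)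
      * ENNReal.ofReal (Real.exp (a * visits J x τ m u))) fun x _ => ?_) ?_
    · rw [mul_comm]
      refine mul_le_mul_left (ENNReal.ofReal_le_ofReal ?_) _
      rw [← Finset.prod_const]
      refine Finset.prod_le_prod (fun j _ => hQ0 _) fun j _ => ?_
      rw [hQ]
      exact hK _ _ (by omega) (by omega)
    · rw [expect_const_mul]
      refine (mul_le_mul_right (ih (by omega)) _).trans_eq ?_
      rw [← ENNReal.ofReal_mul (by positivity), ← pow_add]
      congr 2
      ring

/-- Markov's inequality for the exponential moment. Keeping `a` on both sides of the event covers
the upper tail (`a > 0`) and the lower tail (`a < 0`) together. -/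
lemma visits_tail_le (hΔ : 0 < maxActiveDegree N M)
    (hγ : 2 * maxActiveDegree N M ∣ γ) {τ : ℕ} (J : Finset (V × Fin γ)) (u : V) (a K b : ℝ)
    (hK : ∀ t v, 1 ≤ t → t + τ ≤ N + 1 → 1 + (Real.exp a - 1) * windowProd N M t τ v u ≤ K)
    {m : ℕ} (hm : m * τ ≤ N) :
    (placementLaw N M γ N).toOuterMeasure {x | a * b ≤ a * visits J x τ m u}
      ≤ ENNReal.ofReal (Real.exp (-(a * b)) * K ^ (m * J.card)) := by
  refine (toOuterMeasure_le_expect _ _ (fun x => ENNReal.ofReal (Real.exp (-(a * b)))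
    * ENNReal.ofReal (Real.exp (a * visits J x τ m u))) fun x hx => ?_).trans ?_
  · rw [← ENNReal.ofReal_mul (Real.exp_pos _).le, ← Real.exp_add, ENNReal.one_le_ofReal,
      Real.one_le_exp_iff]
    have : a * b ≤ a * visits J x τ m u := hx
    linarith
  · rw [expect_const_mul, ENNReal.ofReal_mul (Real.exp_pos _).le]
    refine mul_le_mul_right ?_ _
    refine (expect_placementLaw_le_of_dependsUpTo hΔ hγ hm fun x s c hs => ?_).trans
      (expect_exp_visits_le hΔ hγ J u a K hK hm)
    have := dependsUpTo_visits J τ m u x s c hs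
    simp only at this
    rw [this]

/-- The Chernoff exponent divided by `mγ`, at parameter `y = α/8`. Since `exp y - 1 ≤ y + y²`, the
second-order terms and the mixing error `δ` cost at most `3y²`, while the gap `α/2 = 4y` gains
`4y²`; what remains is `-y²`. -/
lemma upper_exponent_le {α β θ δ : ℝ} (h0 : 0 < α) (h1 : α ≤ 1) (hβ0 : 0 ≤ β) (hβ1 : β ≤ 1)
    (hβ : β ≤ θ - α / 2) (hδ0 : 0 ≤ δ) (hδ : δ ≤ α / 8) :
    β * (Real.exp (α / 8) - 1) * (1 + δ) - α / 8 * θ ≤ -(α ^ 2 / 64) := by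
  obtain ⟨y, rfl⟩ : ∃ y, α = 8 * y := ⟨α / 8, by ring⟩
  have he := (abs_le.1 (Real.abs_exp_sub_one_sub_id_le (x := y) (by
    rw [abs_of_pos (by linarith)]; linarith))).2
  rw [show 8 * y / 8 = y by ring] at *
  have h2 : β * (Real.exp y - 1) * (1 + δ) ≤ β * (y + y ^ 2) * (1 + δ) := by gcongr; linarith
  have h3 : β * (y + y ^ 2) * (1 + δ) ≤ β * y + y ^ 2 + y ^ 2 + y ^ 2 := by
    have hy1 : y ≤ 1 := by linarith
    have e1 : β * y ^ 2 ≤ y ^ 2 := by nlinarith [sq_nonneg y]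
    have e2 : β * y * δ ≤ y ^ 2 := by nlinarith [mul_nonneg hβ0 (show 0 ≤ y by linarith)]
    have e3 : β * y ^ 2 * δ ≤ y ^ 2 := by
      have : β * δ ≤ 1 := by nlinarith
      nlinarith [sq_nonneg y]
    nlinarith
  nlinarith

lemma lower_exponent_le {α β θ δ : ℝ} (h0 : 0 < α) (h1 : α ≤ 1) (hβ0 : 0 ≤ β) (hβ1 : β ≤ 1)
    (hβ : θ + α / 2 ≤ β) (hδ0 : 0 ≤ δ) (hδ : δ ≤ α / 8) :
    β * (Real.exp (-(α / 8)) - 1) * (1 - δ) + α / 8 * θ ≤ -(α ^ 2 / 64) := by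
  obtain ⟨y, rfl⟩ : ∃ y, α = 8 * y := ⟨α / 8, by ring⟩
  rw [show 8 * y / 8 = y by ring] at *
  have hy : 0 < y := by linarith
  have he := (abs_le.1 (Real.abs_exp_sub_one_sub_id_le (x := -y) (by
    rw [abs_neg, abs_of_pos hy]; linarith))).2
  have hδ1 : 0 ≤ 1 - δ := by linarith
  have h2 : β * (Real.exp (-y) - 1) * (1 - δ) ≤ β * (-y + y ^ 2) * (1 - δ) := by
    gcongr; linarith
  have h3 : β * (-y + y ^ 2) * (1 - δ) ≤ -(β * y) + y ^ 2 + y ^ 2 := by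
    have e1 : β * y ^ 2 ≤ y ^ 2 := by nlinarith [sq_nonneg y]
    have e2 : β * y * δ ≤ y ^ 2 := by nlinarith [mul_nonneg hβ0 hy.le]
    have e3 : 0 ≤ β * y ^ 2 * δ := by positivity
    nlinarith
  nlinarith

end Tail

/-! ### Tail bounds for the counters -/

section Concentration

open scoped ENNReal

variable {V : Type*} [Fintype V] [DecidableEq V] {N γ : ℕ} {M : ℕ → SimpleGraph V}

lemma visits_upper_tail (hΔ : 0 < maxActiveDegree N M) (hγ : 2 * maxActiveDegree N M ∣ γ)
    (J : Finset (V × Fin γ)) (u : V) {α β θ : ℝ}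
    (hJ : (J.card : ℝ) = β * Fintype.card V * γ) (h0 : 0 < α) (h1 : α ≤ 1) (hβ0 : 0 ≤ β)
    (hβ1 : β ≤ 1) (hβ : β ≤ θ - α / 2) (hn : 1 / (Fintype.card V : ℝ) ^ 4 ≤ α / 8)
    {m : ℕ} (hm : m * tmix N M ≤ N) :
    (placementLaw N M γ N).toOuterMeasure {x | θ * (m * γ) ≤ visits J x (tmix N M) m u}
      ≤ ENNReal.ofReal (Real.exp (-(γ * α ^ 2 / 64)) ^ m) := by
  have hn0 : (Fintype.card V : ℝ) ≠ 0 := by exact_mod_cast (Fintype.card_pos_iff.2 ⟨u⟩).ne'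
  have ha : 0 < α / 8 := by linarith
  set δ : ℝ := 1 / (Fintype.card V : ℝ) ^ 4 with hδ
  set z : ℝ := Real.exp (α / 8) - 1 with hz
  have hz0 : 0 ≤ z := by
    have := Real.add_one_le_exp (α / 8); rw [hz]; linarith
  have h := visits_tail_le hΔ hγ (τ := tmix N M) J u (α / 8)
    -- `(1 + δ)/n = 1/n + 1/n⁵` is the mixing bound on an entry, and `1 + x ≤ exp x` makes the
    -- factors multiply.
    (Real.exp (z * ((1 + δ) / Fintype.card V))) (θ * (m * γ)) (fun t v ht htN => by
      have h1 := (abs_le.1 (abs_windowProd_tmix_sub_le ht htN v u)).2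
      have h2 : windowProd N M t (tmix N M) v u ≤ (1 + δ) / Fintype.card V := by
        have : (1 + δ) / (Fintype.card V : ℝ)
            = 1 / (Fintype.card V : ℝ) + 1 / (Fintype.card V : ℝ) ^ 5 := by
          rw [hδ]; field_simp
        linarith
      have h3 := Real.add_one_le_exp (z * ((1 + δ) / Fintype.card V))
      have h4 := mul_le_mul_of_nonneg_left h2 hz0
      linarith) hm
  refine le_trans (le_of_eq ?_) (h.trans (ENNReal.ofReal_le_ofReal ?_))
  · congr 1
    ext x
    exact (mul_le_mul_iff_right₀ ha).symm
  · rw [← Real.exp_nat_mul, ← Real.exp_nat_mul, ← Real.exp_add, Real.exp_le_exp]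
    have key := upper_exponent_le h0 h1 hβ0 hβ1 hβ (show 0 ≤ δ by positivity) hn
    have hmγ : (0 : ℝ) ≤ m * γ := by positivity
    have := mul_le_mul_of_nonneg_left key hmγ
    push_cast
    rw [hJ]
    have e : (m : ℝ) * (β * Fintype.card V * γ) * (z * ((1 + δ) / Fintype.card V))
        = m * γ * (β * z * (1 + δ)) := by
      field_simp
    rw [e]
    nlinarith

lemma visits_lower_tail (hΔ : 0 < maxActiveDegree N M) (hγ : 2 * maxActiveDegree N M ∣ γ)
    (J : Finset (V × Fin γ)) (u : V) {α β θ : ℝ}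
    (hJ : (J.card : ℝ) = β * Fintype.card V * γ) (h0 : 0 < α) (h1 : α ≤ 1) (hβ0 : 0 ≤ β)
    (hβ1 : β ≤ 1) (hβ : θ + α / 2 ≤ β) (hn : 1 / (Fintype.card V : ℝ) ^ 4 ≤ α / 8)
    {m : ℕ} (hm : m * tmix N M ≤ N) :
    (placementLaw N M γ N).toOuterMeasure {x | visits J x (tmix N M) m u ≤ θ * (m * γ)}
      ≤ ENNReal.ofReal (Real.exp (-(γ * α ^ 2 / 64)) ^ m) := by
  have hn0 : (Fintype.card V : ℝ) ≠ 0 := by exact_mod_cast (Fintype.card_pos_iff.2 ⟨u⟩).ne'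
  have ha : -(α / 8) < 0 := by linarith
  set δ : ℝ := 1 / (Fintype.card V : ℝ) ^ 4 with hδ
  set z : ℝ := Real.exp (-(α / 8)) - 1 with hz
  have hz0 : z ≤ 0 := by
    have : Real.exp (-(α / 8)) ≤ 1 := Real.exp_le_one_iff.2 ha.le
    rw [hz]; linarith
  have h := visits_tail_le hΔ hγ (τ := tmix N M) J u (-(α / 8))
    (Real.exp (z * ((1 - δ) / Fintype.card V))) (θ * (m * γ)) (fun t v ht htN => by
      have h1 := (abs_le.1 (abs_windowProd_tmix_sub_le ht htN v u)).1
      have h2 : (1 - δ) / Fintype.card V ≤ windowProd N M t (tmix N M) v u := by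
        have : (1 - δ) / (Fintype.card V : ℝ)
            = 1 / (Fintype.card V : ℝ) - 1 / (Fintype.card V : ℝ) ^ 5 := by
          rw [hδ]; field_simp
        linarith
      have h3 := Real.add_one_le_exp (z * ((1 - δ) / Fintype.card V))
      have h4 := mul_le_mul_of_nonpos_left h2 hz0
      linarith) hm
  refine le_trans (le_of_eq ?_) (h.trans (ENNReal.ofReal_le_ofReal ?_))
  · congr 1
    ext x
    exact (mul_le_mul_left_of_neg ha).symm
  · rw [← Real.exp_nat_mul, ← Real.exp_nat_mul, ← Real.exp_add, Real.exp_le_exp]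
    have key := lower_exponent_le h0 h1 hβ0 hβ1 hβ (show 0 ≤ δ by positivity) hn
    have hmγ : (0 : ℝ) ≤ m * γ := by positivity
    have := mul_le_mul_of_nonneg_left key hmγ
    push_cast
    rw [hJ]
    have e : (m : ℝ) * (β * Fintype.card V * γ) * (z * ((1 - δ) / Fintype.card V))
        = m * γ * (β * z * (1 - δ)) := by
      field_simp
    rw [e]
    nlinarith

end Concentration

/-! ### Deterministic analysis of broadcast and update -/

section Run

variable {V : Type*} [Fintype V] {N γ k : ℕ} {M : ℕ → SimpleGraph V} {o : V → Fin k}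
  {x : ℕ → V × Fin γ → V} {s : ℕ → V → Vars k}

/-- The tokens labeled `i`. -/
def opinionTokens (γ : ℕ) (o : V → Fin k) (i : Fin k) : Finset (V × Fin γ) :=
  Finset.univ.filter fun j => o j.1 = i

lemma card_opinionTokens (i : Fin k) :
    (opinionTokens γ o i).card = supporters o i * γ := by
  have h : opinionTokens γ o i = (Finset.univ.filter fun u => o u = i) ×ˢ Finset.univ := by
    ext j; simp [opinionTokens]
  rw [h, Finset.card_product, supporters, Set.ncard_eq_toFinset_card', Set.toFinset_ofPred]
  simp

/-- The value of the counter of `u` after `m` updates. -/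
def tally (o : V → Fin k) (x : ℕ → V × Fin γ → V) (τ m : ℕ) (u : V) : ℕ :=
  ∑ r ∈ Finset.range m, (heldLabels o (x ((r + 1) * τ)) u).count (o u)

lemma tally_eq_visits [DecidableEq V] (τ m : ℕ) (u : V) :
    tally o x τ m u = visits (opinionTokens γ o (o u)) x τ m u := by
  refine Finset.sum_congr rfl fun r _ => ?_
  rw [heldLabels, Multiset.count_map, ← Finset.filter_val, Finset.card_val]
  congr 1
  ext j
  simp [opinionTokens, and_comm, eq_comm]

lemma tally_succ (τ m : ℕ) (u : V) :
    tally o x τ (m + 1) u = tally o x τ m u + (heldLabels o (x ((m + 1) * τ)) u).count (o u) :=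
  Finset.sum_range_succ _ _

lemma canTalk_of_transition_pos {t : ℕ} {u v : V} (h : 0 < transition N M t v u) :
    CanTalk M t u v := by
  by_contra hc
  simp only [CanTalk, not_or] at hc
  have : transition N M t v u = 0 := by
    rw [transition, if_neg hc.1, if_neg fun h' => hc.2 h'.symm]
  linarith

/-- The variables of a node within a phase, given that the phase started with fresh estimates. -/
lemma IsRun.within_phase (hr : IsRun N M o x s) {m : ℕ}
    (hbase : ∀ u, (s (m * tmix N M) u).cnt = tally o x (tmix N M) m u ∧
      (s (m * tmix N M) u).dom = o u ∧ (s (m * tmix N M) u).est = tally o x (tmix N M) m u)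
    {i : ℕ} (hi : i < tmix N M) (hN : m * tmix N M + i ≤ N) (u : V) :
    (s (m * tmix N M + i) u).cnt = tally o x (tmix N M) m u ∧
    (∃ w, (s (m * tmix N M + i) u).dom = o w ∧
      (s (m * tmix N M + i) u).est = tally o x (tmix N M) m w) ∧
    (∀ v, 0 < windowProd N M (m * tmix N M + 1) i v u →
      tally o x (tmix N M) m v ≤ (s (m * tmix N M + i) u).est) ∧
    (s (m * tmix N M + i) u).plu = (s (m * tmix N M) u).plu := by
  classical
  induction i generalizing u with
  | zero =>
    refine ⟨(hbase u).1, ⟨u, (hbase u).2⟩, fun v hv => ?_, rfl⟩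
    rw [windowProd_zero, Matrix.one_apply] at hv
    split_ifs at hv with h
    · subst h; exact (hbase v).2.2.ge
    · exact absurd hv (lt_irrefl _)
  | succ i ih =>
    have ih' := ih (by omega) (by omega)
    obtain ⟨w, hw, hmax, hstep, -⟩ := hr.step (m * tmix N M + i) (by omega) u
    have hnd : ¬ tmix N M ∣ m * tmix N M + i + 1 := by
      rw [add_assoc, Nat.dvd_add_right (Dvd.intro_left m rfl)]
      exact fun h => absurd (Nat.le_of_dvd (by omega) h) (by omega)
    rw [← add_assoc, hstep hnd]
    refine ⟨(ih' u).1, (ih' w).2.1, fun v hv => ?_, (ih' u).2.2.2⟩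
    rw [windowProd_succ, Matrix.mul_apply] at hv
    -- A positive entry of the product has a positive summand: its index `a` is the last stop before
    -- `u` on a path that respects time.
    obtain ⟨a, -, ha⟩ := Finset.exists_lt_of_sum_lt (f := fun _ => (0 : ℝ)) (by simpa using hv)
    have ht : m * tmix N M + 1 + i ∈ Finset.Icc 1 N := Finset.mem_Icc.2 ⟨by omega, by omega⟩
    have hQ := windowProd_nonneg (M := M) (t := m * tmix N M + 1) (by omega)
      (show m * tmix N M + 1 + i ≤ N + 1 by omega) v a
    have hP := transition_nonneg (M := M) ht a u
    have hQ' : 0 < windowProd N M (m * tmix N M + 1) i v a := pos_of_mul_pos_left ha hP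
    have hP' : 0 < transition N M (m * tmix N M + 1 + i) a u := pos_of_mul_pos_right ha hQ
    rw [show m * tmix N M + 1 + i = m * tmix N M + i + 1 by omega] at hP'
    exact ((ih' a).2.2.1 v hQ').trans (hmax a (canTalk_of_transition_pos hP'))

lemma IsRun.update_step (hV : 2 ≤ Fintype.card V) (hr : IsRun N M o x s) {m : ℕ}
    (hbase : ∀ u, (s (m * tmix N M) u).cnt = tally o x (tmix N M) m u ∧
      (s (m * tmix N M) u).dom = o u ∧ (s (m * tmix N M) u).est = tally o x (tmix N M) m u)
    (hN : (m + 1) * tmix N M ≤ N) (u : V) :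
    (s ((m + 1) * tmix N M) u).cnt = tally o x (tmix N M) (m + 1) u ∧
    (s ((m + 1) * tmix N M) u).dom = o u ∧
    (s ((m + 1) * tmix N M) u).est = tally o x (tmix N M) (m + 1) u ∧
    ∃ w, (s ((m + 1) * tmix N M) u).plu = o w ∧
      ∀ v, tally o x (tmix N M) m v ≤ tally o x (tmix N M) m w := by
  have hτ := tmix_pos (N := N) (M := M) hV
  -- The last round of a phase broadcasts before it resets. `within_phase` covers the first `i`
  -- rounds, and this last broadcast completes the full window. The new guess therefore refers to
  -- the counters after `m`, not `m + 1`, updates.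
  obtain ⟨i, hi⟩ : ∃ i, tmix N M = i + 1 := ⟨tmix N M - 1, by omega⟩
  have hmul : (m + 1) * tmix N M = m * tmix N M + i + 1 := by rw [Nat.succ_mul]; omega
  have hin := fun v => hr.within_phase hbase (i := i) (by omega) (by omega) v
  obtain ⟨w, hw, hmax, -, hstep⟩ := hr.step (m * tmix N M + i) (by omega) u
  have hs := hstep (by rw [← hmul]; exact Dvd.intro_left _ rfl)
  rw [← hmul] at hs
  rw [hs, tally_succ, (hin u).1]
  refine ⟨rfl, rfl, rfl, ?_⟩
  obtain ⟨w', hw1, hw2⟩ := (hin w).2.1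
  refine ⟨w', hw1, fun v => ?_⟩
  rw [← hw2]
  have hpos := windowProd_tmix_pos (N := N) (M := M) hV (t := m * tmix N M + 1) (by omega)
    (by omega) v u
  have hpos' : 0 < windowProd N M (m * tmix N M + 1) (i + 1) v u := hi ▸ hpos
  rw [windowProd_succ, Matrix.mul_apply] at hpos'
  obtain ⟨a, -, ha⟩ := Finset.exists_lt_of_sum_lt (f := fun _ => (0 : ℝ)) (by simpa using hpos')
  have ht : m * tmix N M + 1 + i ∈ Finset.Icc 1 N := Finset.mem_Icc.2 ⟨by omega, by omega⟩
  have hQ := windowProd_nonneg (M := M) (t := m * tmix N M + 1) (by omega)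
    (show m * tmix N M + 1 + i ≤ N + 1 by omega) v a
  have hP := transition_nonneg (M := M) ht a u
  have hQ' : 0 < windowProd N M (m * tmix N M + 1) i v a := pos_of_mul_pos_left ha hP
  have hP' : 0 < transition N M (m * tmix N M + 1 + i) a u := pos_of_mul_pos_right ha hQ
  rw [show m * tmix N M + 1 + i = m * tmix N M + i + 1 by omega] at hP'
  exact ((hin a).2.2.1 v hQ').trans (hmax a (canTalk_of_transition_pos hP'))

lemma IsRun.phase_start (hV : 2 ≤ Fintype.card V) (hr : IsRun N M o x s) {m : ℕ}
    (hN : m * tmix N M ≤ N) (u : V) :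
    (s (m * tmix N M) u).cnt = tally o x (tmix N M) m u ∧
      (s (m * tmix N M) u).dom = o u ∧ (s (m * tmix N M) u).est = tally o x (tmix N M) m u := by
  induction m generalizing u with
  | zero =>
    rw [zero_mul]
    exact ⟨(hr.init u).1, (hr.init u).2.1, (hr.init u).2.2⟩
  | succ m ih =>
    have h := hr.update_step hV (ih (by rw [Nat.succ_mul] at hN; omega)) hN u
    exact ⟨h.1, h.2.1, h.2.2.1⟩

/-- At any time, the guess is the opinion of a node whose counter was maximal before the last
update. -/
lemma IsRun.plu_eq (hV : 2 ≤ Fintype.card V) (hr : IsRun N M o x s) {t m : ℕ} (ht : t ≤ N)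
    (hm : t / tmix N M = m + 1) (u : V) :
    ∃ w, (s t u).plu = o w ∧ ∀ v, tally o x (tmix N M) m v ≤ tally o x (tmix N M) m w := by
  have hτ := tmix_pos (N := N) (M := M) hV
  have hdm := Nat.div_add_mod' t (tmix N M)
  have hlt := Nat.mod_lt t hτ
  rw [hm] at hdm
  have hN : (m + 1) * tmix N M ≤ N := by omega
  have h1 := hr.within_phase (fun v => hr.phase_start hV hN v) hlt (by omega) u
  rw [hdm] at h1
  rw [h1.2.2.2]
  exact (hr.update_step hV (fun v => hr.phase_start hV (by rw [Nat.succ_mul] at hN; omega) v)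
    hN u).2.2.2

end Run

/-! ### The bias as a gap between shares of the nodes -/

section Bias

variable {V : Type*} [Fintype V] {k : ℕ} {o : V → Fin k} {p : Fin k}

lemma supporters_le_card (i : Fin k) : supporters o i ≤ Fintype.card V := by
  rw [← Nat.card_eq_fintype_card]
  exact Set.ncard_le_card _

lemma IsPlurality.supporters_pos [Nonempty V] (hp : IsPlurality o p) : 0 < supporters o p := by
  obtain ⟨u⟩ := ‹Nonempty V›
  by_cases h : o u = p
  · exact (Set.ncard_pos (Set.toFinite _)).2 ⟨u, h⟩
  · exact lt_of_le_of_lt (Nat.zero_le _) (hp _ h)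

/-- Supporter counts are integers, so the lead is at least 1. This makes the mixing error `n⁻⁴`
small against the bias and keeps the geometric series polynomially bounded. -/
lemma IsPlurality.inv_card_le_bias [Nonempty V] (hp : IsPlurality o p) :
    1 / (Fintype.card V : ℝ) ≤ bias o p := by
  have h : (Finset.univ.erase p).sup (supporters o) + 1 ≤ supporters o p :=
    (Finset.sup_lt_iff hp.supporters_pos).2 fun i hi => hp i (Finset.ne_of_mem_erase hi)
  have h' : (((Finset.univ.erase p).sup (supporters o) : ℕ) : ℝ) + 1 ≤ supporters o p := by
    exact_mod_cast h
  unfold bias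
  gcongr
  linarith

lemma bias_le_one : bias o p ≤ 1 := by
  have h : (supporters o p : ℝ) ≤ Fintype.card V := by exact_mod_cast supporters_le_card p
  unfold bias
  refine div_le_one_of_le₀ ?_ (by positivity)
  have : (0 : ℝ) ≤ ((Finset.univ.erase p).sup (supporters o) : ℕ) := by positivity
  linarith

lemma supporters_div_le_sub_bias {i : Fin k} (hi : i ≠ p) :
    (supporters o i : ℝ) / Fintype.card V
      ≤ (supporters o p : ℝ) / Fintype.card V - bias o p := by
  have h : (supporters o i : ℝ) ≤ ((Finset.univ.erase p).sup (supporters o) : ℕ) := by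
    exact_mod_cast Finset.le_sup (f := supporters o) (Finset.mem_erase.2 ⟨hi, Finset.mem_univ i⟩)
  unfold bias
  rw [← sub_div]
  gcongr
  linarith

end Bias

/-! ### Separated counters and the union bound -/

section Correctness

open scoped ENNReal

variable {V : Type*} [Fintype V] {N γ k : ℕ} {M : ℕ → SimpleGraph V} {o : V → Fin k} {p : Fin k}

/-- After `m` updates the counter of `u` is on the right side of the threshold `θ m γ`. -/
def Separated (o : V → Fin k) (p : Fin k) (θ : ℝ) (τ m : ℕ) (x : ℕ → V × Fin γ → V) (u : V) :
    Prop :=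
  (o u = p → θ * (m * γ) < tally o x τ m u) ∧ (o u ≠ p → (tally o x τ m u : ℝ) < θ * (m * γ))

/-- Some supporter of `p` exists and lies above the threshold, so a node with maximal counter cannot
lie below it. Guesses lag one phase behind the counters, hence `m₀ + 1`. -/
lemma IsRun.plu_eq_plurality (hV : 2 ≤ Fintype.card V) (hp : IsPlurality o p)
    {x : ℕ → V × Fin γ → V} {s : ℕ → V → Vars k} (hr : IsRun N M o x s) {θ : ℝ} {m₀ : ℕ}
    (hx : ∀ m, m₀ ≤ m → m * tmix N M ≤ N → ∀ u, Separated o p θ (tmix N M) m x u)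
    {t : ℕ} (h0 : (m₀ + 1) * tmix N M ≤ t) (ht : t ≤ N) (u : V) : (s t u).plu = p := by
  have hτ := tmix_pos (N := N) (M := M) hV
  have h1 : m₀ + 1 ≤ t / tmix N M := (Nat.le_div_iff_mul_le hτ).2 h0
  obtain ⟨m, hm⟩ : ∃ m, t / tmix N M = m + 1 := ⟨t / tmix N M - 1, by omega⟩
  obtain ⟨w, hw, hmax⟩ := hr.plu_eq hV ht hm u
  have hmN : m * tmix N M ≤ N :=
    (Nat.mul_le_mul_right _ (by omega : m ≤ t / tmix N M)).trans
      ((Nat.div_mul_le_self _ _).trans ht)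
  have hsep := hx m (by omega) hmN
  rw [hw]
  by_contra hne
  have : Nonempty V := ⟨u⟩
  obtain ⟨v, hv⟩ := (Set.ncard_pos (Set.toFinite _)).1 hp.supporters_pos
  have h2 := (hsep v).1 hv
  have h3 := (hsep w).2 hne
  have h4 : (tally o x (tmix N M) m v : ℝ) ≤ tally o x (tmix N M) m w := by
    exact_mod_cast hmax v
  linarith

lemma not_separated_measure_le (hV : 2 ≤ Fintype.card V) (hΔ : 0 < maxActiveDegree N M)
    (hγ : 2 * maxActiveDegree N M ∣ γ) (hp : IsPlurality o p) {m : ℕ}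
    (hm : m * tmix N M ≤ N) (u : V) :
    (placementLaw N M γ N).toOuterMeasure
        {x | ¬ Separated o p ((supporters o p : ℝ) / Fintype.card V - bias o p / 2)
          (tmix N M) m x u}
      ≤ ENNReal.ofReal (Real.exp (-(γ * bias o p ^ 2 / 64)) ^ m) := by
  classical
  have : Nonempty V := ⟨u⟩
  have hn2 : (2 : ℝ) ≤ Fintype.card V := by exact_mod_cast hV
  have hn0 : (0 : ℝ) < Fintype.card V := by linarith
  have hα := hp.inv_card_le_bias
  have hα0 : 0 < bias o p := lt_of_lt_of_le (by positivity) hα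
  have hδ : 1 / (Fintype.card V : ℝ) ^ 4 ≤ bias o p / 8 := by
    have h8 : (8 : ℝ) ≤ (Fintype.card V : ℝ) ^ 3 := by
      calc (8 : ℝ) = 2 ^ 3 := by norm_num
        _ ≤ _ := pow_le_pow_left₀ (by norm_num) hn2 3
    have : 1 / (Fintype.card V : ℝ) ^ 4 ≤ 1 / (Fintype.card V : ℝ) / 8 := by
      rw [div_div, pow_succ']
      gcongr
    linarith
  have hβ1 : (supporters o (o u) : ℝ) / Fintype.card V ≤ 1 :=
    div_le_one_of_le₀ (by exact_mod_cast supporters_le_card _) hn0.le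
  have hβ0 : 0 ≤ (supporters o (o u) : ℝ) / Fintype.card V := by positivity
  have hJ : ((opinionTokens γ o (o u)).card : ℝ)
      = (supporters o (o u) : ℝ) / Fintype.card V * Fintype.card V * γ := by
    rw [card_opinionTokens, div_mul_cancel₀ _ hn0.ne']
    push_cast; ring
  by_cases hu : o u = p
  · refine le_trans (MeasureTheory.measure_mono fun x hx => ?_)
      (visits_lower_tail hΔ hγ (opinionTokens γ o (o u)) u hJ hα0 bias_le_one hβ0 hβ1
        (θ := (supporters o p : ℝ) / Fintype.card V - bias o p / 2) (by rw [hu]; linarith) hδ hm)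
    have hx' : ¬ Separated o p ((supporters o p : ℝ) / Fintype.card V - bias o p / 2)
          (tmix N M) m x u := hx
    simp only [Separated, hu, ne_eq, not_true_eq_false, false_imp_iff, and_true, true_imp_iff,
      not_lt, tally_eq_visits] at hx'
    rw [Set.mem_ofPred_eq, hu]
    exact hx'
  · refine le_trans (MeasureTheory.measure_mono fun x hx => ?_)
      (visits_upper_tail hΔ hγ (opinionTokens γ o (o u)) u hJ hα0 bias_le_one hβ0 hβ1
        (θ := (supporters o p : ℝ) / Fintype.card V - bias o p / 2)
        (by have := supporters_div_le_sub_bias (o := o) hu; linarith) hδ hm)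
    have hx' : ¬ Separated o p ((supporters o p : ℝ) / Fintype.card V - bias o p / 2)
          (tmix N M) m x u := hx
    simp only [Separated, hu, ne_eq, not_false_eq_true, false_imp_iff, true_and, true_imp_iff,
      not_lt, tally_eq_visits] at hx'
    exact hx'

/-- Union bound over `n` nodes and all `m ≥ m₀`. The leading term is at most `n^(-(q+4))`, and `1 -
exp (-ρ) ≥ ρ/(1+ρ) ≥ 1/(65n²) ≥ 1/n³`, so summing costs a factor `n³` and the nodes a factor `n`. -/
lemma card_mul_geom_tail_le {n q m₀ : ℕ} {ρ : ℝ} (hn : 65 ≤ n)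
    (hρ : 1 / (64 * (n : ℝ) ^ 2) ≤ ρ) (hm : (q + 4) * Real.log n ≤ m₀ * ρ) :
    n * (Real.exp (-ρ) ^ m₀ / (1 - Real.exp (-ρ))) ≤ 1 / (n : ℝ) ^ q := by
  have hn' : (65 : ℝ) ≤ n := by exact_mod_cast hn
  have hn0 : (0 : ℝ) < n := by linarith
  have hρ0 : 0 < ρ := lt_of_lt_of_le (by positivity) hρ
  have h1 : Real.exp (-ρ) ^ m₀ ≤ 1 / (n : ℝ) ^ (q + 4) := by
    rw [← Real.exp_nat_mul, one_div, ← Real.exp_log (show (0 : ℝ) < n ^ (q + 4) by positivity),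
      ← Real.exp_neg, Real.exp_le_exp, Real.log_pow]
    push_cast
    linarith
  have h2 : 1 / (1 - Real.exp (-ρ)) ≤ (n : ℝ) ^ 3 := by
    have h3 : Real.exp (-ρ) ≤ 1 / (1 + ρ) := by
      rw [Real.exp_neg, ← one_div]
      exact one_div_le_one_div_of_le (by linarith) (by linarith [Real.add_one_le_exp ρ])
    have h4 : 1 / (65 * (n : ℝ) ^ 2) ≤ 1 - 1 / (1 + ρ) := by
      have h5 : 1 - 1 / (1 + ρ) = ρ / (1 + ρ) := by field_simp; ring
      rw [h5, div_le_div_iff₀ (by positivity) (by positivity)]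
      rw [div_le_iff₀ (by positivity)] at hρ
      have h6 : ρ * 1 ≤ ρ * (n : ℝ) ^ 2 :=
        mul_le_mul_of_nonneg_left (one_le_pow₀ (by linarith)) hρ0.le
      linarith
    have h6 : 1 / (n : ℝ) ^ 3 ≤ 1 / (65 * (n : ℝ) ^ 2) := by
      apply one_div_le_one_div_of_le (by positivity)
      nlinarith [sq_nonneg (n : ℝ)]
    rw [one_div_le (by have : 0 < 1 / (n : ℝ) ^ 3 := by positivity
                       linarith) (by positivity)]
    linarith
  have h7 : 0 ≤ 1 / (1 - Real.exp (-ρ)) := by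
    have : Real.exp (-ρ) < 1 := Real.exp_lt_one_iff.2 (neg_lt_zero.2 hρ0)
    exact one_div_nonneg.2 (by linarith)
  calc n * (Real.exp (-ρ) ^ m₀ / (1 - Real.exp (-ρ)))
      = n * (Real.exp (-ρ) ^ m₀ * (1 / (1 - Real.exp (-ρ)))) := by rw [mul_one_div]
    _ ≤ n * (1 / (n : ℝ) ^ (q + 4) * (n : ℝ) ^ 3) := by gcongr
    _ = 1 / (n : ℝ) ^ q := by field_simp; ring

lemma plurality_probability_ge (hV : 65 ≤ Fintype.card V) (hΔ : 0 < maxActiveDegree N M)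
    (hγ : 2 * maxActiveDegree N M ∣ γ) (hγ0 : 0 < γ) (hp : IsPlurality o p) {q m₀ : ℕ}
    (hm : (q + 4) * Real.log (Fintype.card V) ≤ m₀ * (γ * bias o p ^ 2 / 64)) :
    1 - 1 / (Fintype.card V : ℝ) ^ q ≤
      ((placementLaw N M γ N).toOuterMeasure
        {x | ∀ s, IsRun N M o x s →
          ∀ t, (m₀ + 1) * tmix N M ≤ t → t ≤ N → ∀ u, (s t u).plu = p}).toReal := by
  classical
  have hV2 : 2 ≤ Fintype.card V := by omega
  have : Nonempty V := Fintype.card_pos_iff.1 (by omega)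
  set μ := (placementLaw N M γ N).toOuterMeasure with hμ
  set A := {x : ℕ → V × Fin γ → V | ∀ s, IsRun N M o x s →
          ∀ t, (m₀ + 1) * tmix N M ≤ t → t ≤ N → ∀ u, (s t u).plu = p} with hA
  set r := Real.exp (-(γ * bias o p ^ 2 / 64)) with hr
  set F := (Finset.Ico m₀ (N + 1)).filter fun m => m * tmix N M ≤ N with hF
  set θ := (supporters o p : ℝ) / Fintype.card V - bias o p / 2 with hθ
  have hαn := hp.inv_card_le_bias
  have hρ : 1 / (64 * (Fintype.card V : ℝ) ^ 2) ≤ γ * bias o p ^ 2 / 64 := by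
    have h1 : (1 : ℝ) ≤ γ := by exact_mod_cast hγ0
    have h2 : (1 / (Fintype.card V : ℝ)) ^ 2 ≤ bias o p ^ 2 :=
      pow_le_pow_left₀ (by positivity) hαn 2
    calc 1 / (64 * (Fintype.card V : ℝ) ^ 2) = 1 * (1 / (Fintype.card V : ℝ)) ^ 2 / 64 := by
          field_simp
      _ ≤ _ := by gcongr
  have hr1 : r < 1 := by
    rw [hr, Real.exp_lt_one_iff, neg_lt_zero]
    have : (0 : ℝ) < Fintype.card V := by positivity
    exact lt_of_lt_of_le (by positivity) hρ
  have hcover : Set.univ ⊆ A ∪ ⋃ m ∈ F, ⋃ u ∈ (Finset.univ : Finset V),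
      {x : ℕ → V × Fin γ → V | ¬ Separated o p θ (tmix N M) m x u} := by
    intro x _
    by_cases hx : x ∈ A
    · exact Or.inl hx
    · right
      by_contra hc
      refine hx fun s hs t h0 ht u => hs.plu_eq_plurality hV2 hp (θ := θ) ?_ h0 ht u
      intro m hm0 hmN v
      by_contra hsep
      refine hc (Set.mem_biUnion (x := m) ?_ (Set.mem_biUnion (x := v) (by simp) hsep))
      -- Since `tmix` is positive, only finitely many updates occur and `F` contains all the
      -- relevant ones.
      have : m ≤ N := (Nat.le_mul_of_pos_right m (tmix_pos hV2)).trans hmN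
      simp [hF, hm0, hmN, this]
  have hbad : μ (⋃ m ∈ F, ⋃ u ∈ (Finset.univ : Finset V),
      {x : ℕ → V × Fin γ → V | ¬ Separated o p θ (tmix N M) m x u})
      ≤ ENNReal.ofReal (1 / (Fintype.card V : ℝ) ^ q) := by
    calc _ ≤ ∑ m ∈ F, ∑ u : V, ENNReal.ofReal (r ^ m) := by
          refine (MeasureTheory.measure_biUnion_finset_le F _).trans
            (Finset.sum_le_sum fun m hm => ?_)
          refine (MeasureTheory.measure_biUnion_finset_le _ _).trans
            (Finset.sum_le_sum fun u _ => ?_)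
          exact not_separated_measure_le hV2 hΔ hγ hp (Finset.mem_filter.1 hm).2 u
      _ = ENNReal.ofReal (Fintype.card V * ∑ m ∈ F, r ^ m) := by
          have hr0 : ∀ m, 0 ≤ r ^ m := fun m => by positivity
          rw [ENNReal.ofReal_mul (by positivity), ENNReal.ofReal_sum_of_nonneg fun m _ => hr0 m,
            Finset.mul_sum]
          simp
      _ ≤ _ := by
          refine ENNReal.ofReal_le_ofReal (le_trans ?_ (card_mul_geom_tail_le hV hρ hm))
          refine mul_le_mul_of_nonneg_left ?_ (by positivity)
          refine le_trans ?_ (geom_sum_Ico_le_of_lt_one (m := m₀) (n := N + 1)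
            (Real.exp_pos _).le hr1)
          exact Finset.sum_le_sum_of_subset_of_nonneg (Finset.filter_subset _ _)
            fun _ _ _ => by positivity
  have huniv : μ Set.univ = 1 :=
    (PMF.toOuterMeasure_apply_eq_one_iff _ _).2 (Set.subset_univ _)
  have h1 : 1 ≤ μ A + ENNReal.ofReal (1 / (Fintype.card V : ℝ) ^ q) := by
    rw [← huniv]
    exact (MeasureTheory.measure_mono hcover).trans
      ((MeasureTheory.measure_union_le _ _).trans (add_le_add le_rfl hbad))
  have hAtop : μ A ≠ ⊤ :=
    ne_top_of_le_ne_top ENNReal.one_ne_top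
      (huniv ▸ MeasureTheory.measure_mono (Set.subset_univ A))
  have h2 := ENNReal.toReal_mono (ENNReal.add_ne_top.2 ⟨hAtop, ENNReal.ofReal_ne_top⟩) h1
  rw [ENNReal.toReal_add hAtop ENNReal.ofReal_ne_top, ENNReal.toReal_one,
    ENNReal.toReal_ofReal (by positivity)] at h2
  linarith

end Correctness

/-! ### Counting node states -/

section Memory

variable {V : Type*} [Fintype V] {N γ k : ℕ} {M : ℕ → SimpleGraph V} {o : V → Fin k}

lemma card_heldLabels {pos : V × Fin γ → V} (hpos : Balanced pos) (u : V) :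
    (heldLabels o pos u).card = γ := by
  rw [heldLabels, Multiset.card_map, Finset.card_val, ← Set.ncard_eq_toFinset_card]
  exact hpos u

lemma tally_le {x : ℕ → V × Fin γ → V} {τ m : ℕ} (hx : ∀ r < m, Balanced (x ((r + 1) * τ)))
    (u : V) : tally o x τ m u ≤ γ * m := by
  calc tally o x τ m u ≤ ∑ r ∈ Finset.range m, γ := by
        refine Finset.sum_le_sum fun r hr => ?_
        exact (Multiset.count_le_card _ _).trans_eq
          (card_heldLabels (hx r (Finset.mem_range.1 hr)) u)
    _ = _ := by simp [mul_comm]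

lemma exists_map_univ_eq {A : Type*} (s : Multiset A) (h : s.card = γ) :
    ∃ f : Fin γ → A, (Finset.univ : Finset (Fin γ)).val.map f = s := by
  induction s using Quotient.inductionOn with
  | _ l =>
    obtain rfl : l.length = γ := h
    exact ⟨l.get, by simp [Fin.univ_val_map]⟩

lemma fitsInBits_of_subset_range {T : Type*} [Fintype T] [Nonempty T] {S : Set (NodeState k)}
    (Ψ : T → NodeState k) (hS : S ⊆ Set.range Ψ) :
    FitsInBits S (Nat.clog 2 (Fintype.card T)) := by
  have hcard : Fintype.card T ≤ Fintype.card (Fin (Nat.clog 2 (Fintype.card T)) → Bool) := by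
    simpa using Nat.le_pow_clog (by norm_num : 1 < 2) (Fintype.card T)
  obtain ⟨e⟩ := Function.Embedding.nonempty_of_card_le hcard
  refine ⟨fun σ => e (Function.invFun Ψ σ), fun σ hσ σ' hσ' h => ?_⟩
  rw [← Function.invFun_eq (hS hσ), e.injective h, Function.invFun_eq (hS hσ')]

/-- The count is `k^γ` for the token labels, `k³` for own opinion, `dom` and `plu`, one more factor
for the clock, and a square for `cnt` and `est`: an estimate is always the counter of some node, so
both obey the same bound. -/
lemma nodeStates_fitsInBits (hV : 2 ≤ Fintype.card V) (hk : 0 < k) (R : ℕ) :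
    FitsInBits (nodeStates N M γ k R)
      (Nat.clog 2 (k ^ (γ + 3) * (γ * (R / tmix N M) + 1) ^ 2 * (R + 1))) := by
  set A := γ * (R / tmix N M) + 1 with hA
  have : NeZero k := ⟨hk.ne'⟩
  have hcard : Fintype.card ((Fin γ → Fin k) × (Fin k × Fin k × Fin k) × (Fin A × Fin A)
      × Fin (R + 1)) = k ^ (γ + 3) * A ^ 2 * (R + 1) := by
    simp only [Fintype.card_prod, Fintype.card_fun, Fintype.card_fin]
    ring
  rw [← hcard]
  refine fitsInBits_of_subset_range
    (fun z : (Fin γ → Fin k) × (Fin k × Fin k × Fin k) × (Fin A × Fin A) × Fin (R + 1) =>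
      (⟨(Finset.univ : Finset (Fin γ)).val.map z.1, z.2.1.1,
        ⟨z.2.2.1.1, z.2.1.2.1, z.2.2.1.2, z.2.1.2.2⟩, z.2.2.2⟩ : NodeState k)) ?_
  rintro _ ⟨o, x, s, t, u, hx, hr, htR, htN, rfl⟩
  have hτ := tmix_pos (N := N) (M := M) hV
  have hbal := balanced_of_mem_support_placementLaw hx
  obtain ⟨f, hf⟩ := exists_map_univ_eq _ (card_heldLabels (o := o) (hbal t htN) u)
  have hdm := Nat.div_add_mod' t (tmix N M)
  have hmN : t / tmix N M * tmix N M ≤ N := (Nat.div_mul_le_self _ _).trans htN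
  have hin := hr.within_phase (fun v => hr.phase_start hV hmN v) (Nat.mod_lt t hτ)
    (by omega) u
  rw [hdm] at hin
  have htal : ∀ v, tally o x (tmix N M) (t / tmix N M) v < A := by
    intro v
    refine Nat.lt_succ_of_le ((tally_le (fun r hr => hbal _ ?_) v).trans ?_)
    · exact (Nat.mul_le_mul_right _ hr).trans hmN
    · exact Nat.mul_le_mul_left _ (Nat.div_le_div_right htR)
  obtain ⟨w, -, hw⟩ := hin.2.1
  refine ⟨(f, (o u, (s t u).dom, (s t u).plu), (⟨(s t u).cnt, hin.1 ▸ htal u⟩,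
    ⟨(s t u).est, hw ▸ htal w⟩), ⟨t, Nat.lt_succ_of_le htR⟩), ?_⟩
  simp [hf]

lemma clog_states_le {γ k C T τ : ℕ} {g Y : ℝ} (hk : 0 < k) (hC : 1 ≤ C) (hT : 0 < T)
    (hτ : 0 < τ) (hγ1 : (γ : ℝ) ≤ g + 1) (hg : 1 ≤ g) (hY : Y = g * T)
    (hYC : 12 * (C : ℝ) ^ 2 ≤ Y) :
    (Nat.clog 2 (k ^ (γ + 3) * (γ * (C * T) + 1) ^ 2 * (C * T * τ + 1)) : ℝ)
      ≤ (g + 4) * Real.logb 2 k + 4 * Real.logb 2 Y + Real.logb 2 (T * τ) := by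
  have hC' : (1 : ℝ) ≤ C := by exact_mod_cast hC
  have hT' : (1 : ℝ) ≤ T := by exact_mod_cast hT
  have hτ' : (1 : ℝ) ≤ τ := by exact_mod_cast hτ
  have hk' : (1 : ℝ) ≤ k := by exact_mod_cast hk
  have hY0 : 1 ≤ Y := by nlinarith
  have hTτ : 1 ≤ (T : ℝ) * τ := by nlinarith
  have hA : (γ : ℝ) * (C * T) + 1 ≤ 3 * C * Y := by
    have h1 : (γ : ℝ) * (C * T) ≤ (2 * g) * (C * T) := by gcongr; linarith
    have h2 : (2 * g) * (C * T) = 2 * (C * Y) := by rw [hY]; ring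
    have h3 : 1 ≤ C * Y := by nlinarith
    linarith
  have hR : (C : ℝ) * T * τ + 1 ≤ 2 * C * (T * τ) := by nlinarith
  -- The extra factor 2 pays for rounding up to whole bits. Counters and clock need only `Y²`; the
  -- spare `Y²` absorbs the constant `36C³`.
  have hprod : ((γ : ℝ) * (C * T) + 1) ^ 2 * (C * T * τ + 1) * 2 ≤ Y ^ 4 * (T * τ) := by
    have hY2 : 36 * (C : ℝ) ^ 3 ≤ Y ^ 2 := by
      have h1 : (12 * (C : ℝ) ^ 2) ^ 2 ≤ Y ^ 2 := pow_le_pow_left₀ (by positivity) hYC 2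
      have h2 : (C : ℝ) ^ 3 ≤ (C : ℝ) ^ 4 := pow_le_pow_right₀ hC' (by norm_num)
      have h3 : 0 ≤ (C : ℝ) ^ 4 := by positivity
      nlinarith
    calc ((γ : ℝ) * (C * T) + 1) ^ 2 * (C * T * τ + 1) * 2
        ≤ (3 * C * Y) ^ 2 * (2 * C * (T * τ)) * 2 := by gcongr
      _ = 36 * (C : ℝ) ^ 3 * (Y ^ 2 * (T * τ)) := by ring
      _ ≤ Y ^ 2 * (Y ^ 2 * (T * τ)) := by gcongr
      _ = _ := by ring
  have h2 : (1 : ℝ) < 2 := by norm_num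
  have hpos : (0 : ℝ) < (γ : ℝ) * (C * T) + 1 := by positivity
  have hlogk : 0 ≤ Real.logb 2 k := Real.logb_nonneg h2 hk'
  rw [← Real.natCeil_logb_natCast]
  have hceil := (Nat.ceil_lt_add_one (a := Real.logb (2 : ℕ)
    ((k ^ (γ + 3) * (γ * (C * T) + 1) ^ 2 * (C * T * τ + 1) : ℕ) : ℝ))
    (Real.logb_nonneg (by norm_num) (by exact_mod_cast Nat.one_le_iff_ne_zero.2 (by positivity)))).le
  refine hceil.trans ?_
  push_cast
  rw [mul_assoc, Real.logb_mul (by positivity) (by positivity), Real.logb_pow]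
  have h3 : Real.logb 2 (((γ : ℝ) * (C * T) + 1) ^ 2 * (C * T * τ + 1)) + 1
      ≤ 4 * Real.logb 2 Y + Real.logb 2 (T * τ) := by
    have h4 := Real.logb_le_logb_of_le h2 (by positivity) hprod
    rw [Real.logb_mul (by positivity) (by norm_num), Real.logb_self_eq_one h2,
      Real.logb_mul (x := Y ^ 4) (by positivity) (by positivity),
      show Real.logb 2 (Y ^ 4) = 4 * Real.logb 2 Y by rw [Real.logb_pow]; norm_num] at h4
    exact h4
  have h5 : ((γ + 3 : ℕ) : ℝ) * Real.logb 2 k ≤ (g + 4) * Real.logb 2 k := by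
    refine mul_le_mul_of_nonneg_right ?_ hlogk
    push_cast; linarith
  linarith

end Memory

end

end Plurality

/-! ### Choice of the constants -/

open Plurality
theorem theorem1 (q : ℕ) :
    ∃ C n₀ : ℕ, ∀ n : ℕ, n₀ ≤ n →
      ∀ (N : ℕ) (M : ℕ → SimpleGraph (Fin n)) (k : ℕ) (o : Fin n → Fin k) (p : Fin k),
        IsPlurality o p →
      ∀ (T : ℕ) (c : ℝ) (γ : ℕ), 0 < T → 12 ≤ c →
        γ = tokensPerNode c n (bias o p) T →
        2 * maxActiveDegree N M ∣ γ →
        1 - 1 / (n : ℝ) ^ q ≤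
          ((placementLaw N M γ N).toOuterMeasure
            {x | ∀ s, IsRun N M o x s →
              ∀ t, C * T * tmix N M ≤ t → t ≤ N → ∀ u, (s t u).plu = p}).toReal ∧
        ∃ b : ℕ,
          FitsInBits (nodeStates N M γ k (C * T * tmix N M)) b ∧
          (b : ℝ) ≤ (c * Real.logb 2 n / (bias o p ^ 2 * T) + 4) * Real.logb 2 k
            + 4 * Real.logb 2 (c * Real.logb 2 n / bias o p ^ 2)
            + Real.logb 2 (T * tmix N M) := by
  -- The 6 works because `6 * 12 ≥ 64`, with 12 from `c ≥ 12` and 64 from the Chernoff exponent; the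
  -- `+ 1` pays for the lag of one phase.
  obtain ⟨C, hC⟩ : ∃ C, C = 6 * (q + 4) + 1 := ⟨_, rfl⟩
  -- `2 ^ C ^ 2` gives `C² ≤ logb 2 n` for the memory bound; 65 is for the geometric tail.
  refine ⟨C, 2 ^ C ^ 2 + 65, fun n hn N M k o p hp T c γ hT hc hγ hdvd => ?_⟩
  have hn65 : 65 ≤ n := (Nat.le_add_left _ _).trans hn
  have hV : 65 ≤ Fintype.card (Fin n) := by rwa [Fintype.card_fin]
  have : Nonempty (Fin n) := Fintype.card_pos_iff.1 (by omega)
  have hn' : (65 : ℝ) ≤ n := by exact_mod_cast hn65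
  have hT' : (1 : ℝ) ≤ T := by exact_mod_cast hT
  have hα0 : 0 < bias o p := lt_of_lt_of_le (by positivity) hp.inv_card_le_bias
  have hα1 : bias o p ≤ 1 := bias_le_one
  have hlog : (C : ℝ) ^ 2 ≤ Real.logb 2 n := by
    rw [Real.le_logb_iff_rpow_le (by norm_num) (by linarith)]
    have : ((2 ^ C ^ 2 : ℕ) : ℝ) ≤ n := by exact_mod_cast (Nat.le_add_right _ _).trans hn
    exact_mod_cast this
  have hC1 : (1 : ℝ) ≤ C := by exact_mod_cast (by omega : 1 ≤ C)
  have hlog0 : 0 < Real.logb 2 n := by nlinarith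
  obtain ⟨g, hg⟩ : ∃ g, g = c * Real.logb 2 n / (bias o p ^ 2 * T) := ⟨_, rfl⟩
  have hg0 : 0 < g := by rw [hg]; positivity
  have hγg : γ = ⌈g⌉₊ := by rw [hγ, hg]; rfl
  have hγ0 : 0 < γ := by rw [hγg]; exact Nat.ceil_pos.2 hg0
  have hΔ : 0 < maxActiveDegree N M := by
    rw [Nat.pos_iff_ne_zero]
    intro h
    rw [h] at hdvd
    have := Nat.eq_zero_of_zero_dvd hdvd
    omega
  -- Divisibility by `2Δ` excludes `γ = 1`, hence `g ≥ 1` and `γ ≤ g + 1 ≤ 2g`, which the state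
  -- count needs.
  have hγ2 : 2 ≤ γ := by
    have := Nat.le_of_dvd hγ0 hdvd
    omega
  have hg1 : 1 ≤ g := by
    by_contra h
    have : ⌈g⌉₊ ≤ 1 := Nat.ceil_le.2 (by push_cast; linarith)
    omega
  have hgT : c * Real.logb 2 n / bias o p ^ 2 = g * T := by
    rw [hg]; field_simp
  constructor
  · have hCT : C * T - 1 + 1 = C * T :=
      Nat.sub_add_cancel (Nat.mul_pos (by omega) hT)
    have key := plurality_probability_ge hV hΔ hdvd hγ0 hp (q := q) (m₀ := C * T - 1) ?_
    · rw [hCT] at key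
      simpa only [Fintype.card_fin] using key
    · rw [Fintype.card_fin]
      have hm0 : (6 * ((q : ℝ) + 4)) * T ≤ ((C * T - 1 : ℕ) : ℝ) := by
        have : 6 * (q + 4) * T ≤ C * T - 1 := by
          rw [hC, add_mul _ 1, one_mul]
          exact Nat.le_sub_of_add_le (Nat.add_le_add_left hT _)
        exact_mod_cast this
      have hγα : 12 * Real.log n ≤ γ * bias o p ^ 2 * T := by
        have h1 : g ≤ γ := by rw [hγg]; exact Nat.le_ceil g
        have h2 : Real.log n ≤ Real.logb 2 n := by
          rw [Real.logb, le_div_iff₀ (Real.log_pos (by norm_num))]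
          have := Real.log_two_lt_d9
          have h3 : 0 ≤ Real.log n := Real.log_nonneg (by linarith)
          nlinarith
        calc 12 * Real.log n ≤ c * Real.logb 2 n :=
              mul_le_mul hc h2 (Real.log_nonneg (by linarith)) (by linarith)
          _ = g * (bias o p ^ 2 * T) := by rw [hg]; field_simp
          _ ≤ γ * (bias o p ^ 2 * T) := by gcongr
          _ = _ := by ring
      have h3 : 0 ≤ Real.log n := Real.log_nonneg (by linarith)
      calc ((q : ℝ) + 4) * Real.log n ≤ (6 * ((q : ℝ) + 4)) / 64 * (12 * Real.log n) := by
            have : 0 ≤ ((q : ℝ) + 4) * Real.log n := by positivity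
            linarith
        _ ≤ (6 * ((q : ℝ) + 4)) / 64 * (γ * bias o p ^ 2 * T) := by gcongr
        _ = (6 * ((q : ℝ) + 4)) * T * (γ * bias o p ^ 2 / 64) := by ring
        _ ≤ _ := by gcongr
  · have hτ : 0 < tmix N M := tmix_pos (by omega)
    have hk : 0 < k := lt_of_le_of_lt (Nat.zero_le _) p.isLt
    refine ⟨_, nodeStates_fitsInBits (by omega) hk _, ?_⟩
    rw [Nat.mul_div_cancel _ hτ, hgT, ← hg]
    refine clog_states_le hk (by omega) hT hτ ?_ hg1 rfl ?_
    · rw [hγg]; exact (Nat.ceil_lt_add_one hg0.le).le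
    · rw [← hgT, le_div_iff₀ (by positivity)]
      have h1 : bias o p ^ 2 ≤ 1 := pow_le_one₀ hα0.le hα1
      calc 12 * (C : ℝ) ^ 2 * bias o p ^ 2 ≤ 12 * (C : ℝ) ^ 2 * 1 := by gcongr
        _ ≤ c * Real.logb 2 n := by
            rw [mul_one]
            exact mul_le_mul hc hlog (by positivity) (by linarith)
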